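/- A \emph{map on the sphere} is a finite family of pairwise disjoint, nonempty, connected open subsets of the sphere $S^2$ (the countries, taken without their boundaries) whose union is dense in $S^2$. A point lying in the closures of at least three countries is called a corner, and two distinct countries are \emph{neighbours} if their closures have a common point that is not a corner. An \emph{$m$-pire map} is a map together with a grouping of its countries into empires, each of which consists of at most $m$ countries. Two distinct empires are \emph{neighbouring} if some country of the one is a neighbour of some country of the other. A proper colouring assigns one colour to each empire so that neighbouring empires get different colours. \textbf{Theorem.} Let $m \ge 2$ be an integer. (1) Every $m$-pire map on the sphere can be properly coloured with $6m$ colours. (2) This bound is sharp: there is an $m$-pire map on the sphere, with exactly $6m$ empires any two of which are neighbouring, such that the smallest number of colours in a proper colouring is exactly $6m$. -/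

import Mathlib

/-- The two-dimensional unit sphere, with its usual topology. -/
abbrev Sphere2 : Type := Metric.sphere (0 : EuclideanSpace ℝ (Fin 3)) 1

/-- A map on the sphere with countries indexed by `ι`: a family of pairwise disjoint, nonempty,
connected open subsets of the sphere (the interiors of the countries) that fills the sphere up to
boundaries, i.e. whose union is dense. The type `ι` is finite wherever maps are used. -/
structure SphereMap (ι : Type*) where
  country : ι → Set Sphere2
  isOpen_country : ∀ i, IsOpen (country i)
  isConnected_country : ∀ i, IsConnected (country i)
  disjoint_country : Pairwise fun i j => Disjoint (country i) (country j)
  dense_iUnion : Dense (⋃ i, country i)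

namespace SphereMap

variable {ι A : Type*}

/-- A corner of a map is a point at which at least three countries meet. -/
def IsCorner (M : SphereMap ι) (p : Sphere2) : Prop :=
  ∃ i j k, i ≠ j ∧ j ≠ k ∧ i ≠ k ∧
    p ∈ closure (M.country i) ∧ p ∈ closure (M.country j) ∧ p ∈ closure (M.country k)

/-- Two distinct countries are neighbours if they have a common boundary point that is not a
corner. Countries that only meet at corners are not neighbours. -/
def countryGraph (M : SphereMap ι) : SimpleGraph ι where
  Adj i j := i ≠ j ∧
    ∃ p, p ∈ closure (M.country i) ∧ p ∈ closure (M.country j) ∧ ¬ M.IsCorner p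
  symm := ⟨fun _ _ ⟨hne, p, hi, hj, hp⟩ => ⟨hne.symm, p, hj, hi, hp⟩⟩
  loopless := ⟨fun _ h => h.1 rfl⟩

/-- The countries are grouped into empires by `h`, the country `i` belonging to the empire `h i`.
Two distinct empires are neighbouring if some country of the one is a neighbour of some country
of the other. A proper colouring of the empire map is a proper vertex colouring of this graph:
all countries of an empire get the same colour, and neighbouring empires different ones. -/
def empireGraph (M : SphereMap ι) (h : ι → A) : SimpleGraph A where
  Adj a b := a ≠ b ∧ ∃ i j, h i = a ∧ h j = b ∧ M.countryGraph.Adj i j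
  symm := ⟨fun _ _ ⟨hne, i, j, hi, hj, hij⟩ => ⟨hne.symm, j, i, hj, hi, hij.symm⟩⟩
  loopless := ⟨fun _ h => h.1 rfl⟩

end SphereMap

/-- The grouping `h` of countries into empires is `m`-pire: every empire consists of at most `m`
countries. -/
def IsMPire {ι A : Type*} (m : ℕ) (h : ι → A) : Prop :=
  ∀ a, (h ⁻¹' {a}).encard ≤ m

open Filter Topology

/-! ### The integer grid and chains modulo two -/

namespace Grid

/-! Upper bound. Any finite set of `s` empires has at most `m s` countries. A planar graph on `k`
vertices has at most `3 k - 3` edges, so these empires have fewer than `6 m` neighbours within the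
set on average. Some empire therefore has fewer than `6 m`, and greedy colouring finishes
(`exists_few_neighbours`, `SimpleGraph.exists_coloring_of_degenerate`).

Since countries are arbitrary connected open sets, the edge bound is where topology enters. A point
of the sphere outside all countries is removed, which leaves a plane. There each country is replaced
by a finite connected set of vertices of a fine grid, with tentacles near chosen contact points, so
that each adjacency becomes one grid edge (`Grid.Drawing`). For such a drawing Euler's inequality is
proved by homology modulo two. Every cycle is a combination of region boundaries (`mem_span_bd`), a
nonzero region boundary has at least three edges, and every edge lies on at most two regions. With
`E` edges and `k` vertices the cycle space has dimension at least `E - k + 1`, so `3 (E - k + 1) ≤ 2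
E` (`card_edges_add_three_le`).

Sharpness. A family of horizontal bars gives a map whose countries are the regions above the bars,
and bars that are consecutive in some column are neighbours (`Bars.exists_sphereMap`). It remains to
label bars by `6 m` empires, at most `m` bars each, so that any two labels touch. For `m = 2, 3`
explicit tables are checked by computation.

For `m = n + 1 ≥ 4` the labels are the residues modulo `6 n + 5` and one extra label. The hub `j`
has label `j (n + 1)`, and since `6 (n + 1) = 1` every residue is the label of a hub. Between the
hubs `j` and `j + 1` lies a path of `n` bars with labels `j (n + 1) + zigzag n i`. The contacts
hub-path, path-next hub, path-path, hub-next hub, hub-second next hub and first path bar-second next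
hub realise all differences from `1` to `3 n + 2` (`labelsMeet_add`), hence all differences up to
sign. The extra label uses four bars, whence `m ≥ 4`. -/

/-- The end of the grid edge `ε` with the larger coordinates. The edge `(v, true)` goes up from
`v`, and `(v, false)` goes to the right. -/
def top (ε : (ℤ × ℤ) × Bool) : ℤ × ℤ :=
  if ε.2 then (ε.1.1, ε.1.2 + 1) else (ε.1.1 + 1, ε.1.2)

/-- The face to the left of, or below, the grid edge `ε`. A face carries the name of its lower left
vertex, so the other face at `ε` is `ε.1`. -/
def face (ε : (ℤ × ℤ) × Bool) : ℤ × ℤ :=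
  if ε.2 then (ε.1.1 - 1, ε.1.2) else (ε.1.1, ε.1.2 - 1)

/-- The crossing number modulo two of the edge `ε` with the ray from `v` to the right. -/
def ray (ε : (ℤ × ℤ) × Bool) (v : ℤ × ℤ) : ZMod 2 :=
  if ε.2 = false ∧ v.2 = ε.1.2 ∧ v.1 ≤ ε.1.1 then 1 else 0

/-- The two grid vertices `p` and `q` are the ends of a grid edge. -/
def Step (p q : ℤ × ℤ) : Prop :=
  ∃ ε : (ℤ × ℤ) × Bool, (p = ε.1 ∧ q = top ε) ∨ (q = ε.1 ∧ p = top ε)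

lemma Step.symm {p q : ℤ × ℤ} (h : Step p q) : Step q p := by
  obtain ⟨ε, h⟩ := h
  exact ⟨ε, h.symm⟩

/-- The face function of a single edge. -/
def cut (ε : (ℤ × ℤ) × Bool) (F : ℤ × ℤ) : ZMod 2 :=
  if ε.2 = true ∧ ε.1.1 ≤ F.1 ∧ F.2 = ε.1.2 then 1 else 0

/-- For a vertical edge `ε`, the faces to its right form a half-infinite strip bounded by `ε` and
the rays from its two ends. For a horizontal edge the two rays differ by `ε` itself, so the zero
function does. -/
lemma cut_add_cut (ε η : (ℤ × ℤ) × Bool) :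
    cut ε η.1 + cut ε (face η) = (if η = ε then 1 else 0) + ray η ε.1 + ray η (top ε) := by
  obtain ⟨⟨a, b⟩, o⟩ := ε
  obtain ⟨⟨x, y⟩, p⟩ := η
  have h2 : (1 : ZMod 2) + 1 = 0 := rfl
  cases o <;> cases p <;>
    simp only [cut, face, ray, top, Prod.mk.injEq, Bool.false_eq_true, if_true, if_false,
      true_and, false_and, and_true, and_false, reduceCtorEq, add_zero, zero_add] <;>
    split_ifs <;> first | rfl | (exfalso; omega)

/-- A chain modulo two from `a` to `b` whose edges lie in `S`. -/
def Chain (S : Set (ℤ × ℤ)) (a b : ℤ × ℤ) (f : ℤ × ℤ → ZMod 2) (μ : (ℤ × ℤ) × Bool → ZMod 2) :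
    Prop :=
  (∀ ε, f ε.1 + f (face ε) = μ ε + ray ε a + ray ε b) ∧ ∀ ε, μ ε ≠ 0 → ε.1 ∈ S ∧ top ε ∈ S

/-- The functions `cut` are added along the path; the ray from every intermediate vertex occurs
twice and cancels. In effect a path closed up by two rays to infinity bounds modulo two. -/
lemma exists_chain {S : Set (ℤ × ℤ)} {a b : ℤ × ℤ}
    (h : Relation.ReflTransGen (fun p q => Step p q ∧ p ∈ S ∧ q ∈ S) a b) :
    ∃ f μ, Chain S a b f μ := by
  induction h with
  | refl =>
    refine ⟨0, 0, fun ε => ?_, by simp⟩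
    simp [CharTwo.add_self_eq_zero]
  | tail _ hbc ih =>
    obtain ⟨f, μ, hf, hμ⟩ := ih
    obtain ⟨⟨ε, hε⟩, hb, hc⟩ := hbc
    refine ⟨f + cut ε, μ + Pi.single ε 1, fun η => ?_, fun η hη => ?_⟩
    · have h1 := hf η
      have h2 := cut_add_cut ε η
      simp only [Pi.add_apply, Pi.single_apply]
      rcases hε with ⟨rfl, rfl⟩ | ⟨rfl, rfl⟩
      · linear_combination h1 + h2 + CharTwo.add_self_eq_zero (ray η ε.1)
      · linear_combination h1 + h2 + CharTwo.add_self_eq_zero (ray η (top ε))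
    · by_cases he : η = ε
      · subst he
        rcases hε with ⟨rfl, rfl⟩ | ⟨rfl, rfl⟩
        exacts [⟨hb, hc⟩, ⟨hc, hb⟩]
      · exact hμ η (by simpa [he] using hη)

end Grid

/-! ### Homology modulo two of a drawing on the grid, and the edge bound. -/

namespace Grid

/-- The sum of the jumps of a face function over the edges that leave a finite set of vertices is
zero modulo two. -/
lemma sum_jump_eq_zero (g : ℤ × ℤ → ZMod 2) (S : Finset (ℤ × ℤ)) (K : Finset ((ℤ × ℤ) × Bool))
    (hK : ∀ ε : (ℤ × ℤ) × Bool, ε.1 ∈ S ∨ top ε ∈ S → ε ∈ K) :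
    ∑ ε ∈ K, (g ε.1 + g (face ε)) *
      ((if ε.1 ∈ S then 1 else 0) + (if top ε ∈ S then 1 else 0)) = 0 := by
  classical
  set J : (ℤ × ℤ) × Bool → ZMod 2 := fun ε => g ε.1 + g (face ε) with hJ
  have h1 : ∑ ε ∈ K, J ε * (if ε.1 ∈ S then 1 else 0) = ∑ v ∈ S, (J (v, true) + J (v, false)) := by
    simp only [mul_ite, mul_one, mul_zero, ← Finset.sum_filter]
    rw [← Finset.sum_product' S Finset.univ (fun v b => J (v, b)) |>.trans
      (Finset.sum_congr rfl fun v _ => by simp)]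
    refine Finset.sum_congr ?_ fun _ _ => rfl
    ext ε
    simp only [Finset.mem_filter, Finset.mem_product, Finset.mem_univ, and_true]
    exact ⟨fun h => h.2, fun h => ⟨hK ε (Or.inl h), h⟩⟩
  have h2 : ∑ ε ∈ K, J ε * (if top ε ∈ S then 1 else 0) =
      ∑ v ∈ S, (J ((v.1, v.2 - 1), true) + J ((v.1 - 1, v.2), false)) := by
    simp only [mul_ite, mul_one, mul_zero, ← Finset.sum_filter]
    rw [← Finset.sum_product' S Finset.univ
      (fun v b => J (if b then (v.1, v.2 - 1) else (v.1 - 1, v.2), b)) |>.trans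
      (Finset.sum_congr rfl fun v _ => by simp)]
    refine Finset.sum_nbij' (fun ε => (top ε, ε.2))
      (fun x => (if x.2 then (x.1.1, x.1.2 - 1) else (x.1.1 - 1, x.1.2), x.2)) ?_ ?_ ?_ ?_ ?_
    · rintro ε hε
      simpa using (Finset.mem_filter.1 hε).2
    · rintro ⟨⟨x, y⟩, b⟩ h
      have h' : (x, y) ∈ S := by simpa using h
      have : top ((if b then (x, y - 1) else (x - 1, y), b) : (ℤ × ℤ) × Bool) = (x, y) := by
        cases b <;> simp [top]
      exact Finset.mem_filter.2 ⟨hK _ (Or.inr (by rw [this]; exact h')), by rw [this]; exact h'⟩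
    · rintro ⟨⟨x, y⟩, b⟩ -
      cases b <;> simp [top]
    · rintro ⟨⟨x, y⟩, b⟩ -
      cases b <;> simp [top]
    · rintro ⟨⟨x, y⟩, b⟩ -
      cases b <;> simp [top]
  simp only [mul_add, Finset.sum_add_distrib]
  rw [h1, h2, ← Finset.sum_add_distrib]
  -- Each of the four faces around a vertex borders exactly two of the four edges there.
  refine Finset.sum_eq_zero fun v _ => ?_
  obtain ⟨x, y⟩ := v
  simp only [hJ, face, if_true, Bool.false_eq_true, if_false]
  linear_combination CharTwo.add_self_eq_zero (g (x, y)) +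
    CharTwo.add_self_eq_zero (g (x - 1, y)) + CharTwo.add_self_eq_zero (g (x, y - 1)) +
    CharTwo.add_self_eq_zero (g (x - 1, y - 1))

variable {ι E : Type*}

/-- The graph with vertex set `ι` and edge set `E` is drawn on the grid: the vertices are finite
connected sets, and the edges are grid edges between them. -/
structure Drawing (ι E : Type*) where
  S : ι → Finset (ℤ × ℤ)
  base : ι → ℤ × ℤ
  src : E → ι
  tgt : E → ι
  r : E → (ℤ × ℤ) × Bool
  disj : ∀ {i j v}, v ∈ S i → v ∈ S j → i = j
  conn : ∀ {i v}, v ∈ S i →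
    Relation.ReflTransGen (fun p q => Step p q ∧ p ∈ S i ∧ q ∈ S i) (base i) v
  ne : ∀ e, src e ≠ tgt e
  inj : ∀ {e e'}, src e = src e' → tgt e = tgt e' → e = e'
  inj' : ∀ {e e'}, src e = tgt e' → tgt e = src e' → e = e'
  r_src : ∀ e, (r e).1 ∈ S (src e)
  r_tgt : ∀ e, top (r e) ∈ S (tgt e)

namespace Drawing

variable (D : Drawing ι E)

lemma r_injective : Function.Injective D.r := fun e e' h =>
  D.inj (D.disj (D.r_src e) (h ▸ D.r_src e')) (D.disj (D.r_tgt e) (h ▸ D.r_tgt e'))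

lemma src_mem_iff {e : E} {i : ι} : (D.r e).1 ∈ D.S i ↔ D.src e = i :=
  ⟨fun h => D.disj (D.r_src e) h, fun h => h ▸ D.r_src e⟩

lemma tgt_mem_iff {e : E} {i : ι} : top (D.r e) ∈ D.S i ↔ D.tgt e = i :=
  ⟨fun h => D.disj (D.r_tgt e) h, fun h => h ▸ D.r_tgt e⟩

/-- The grid edge `ε` is crossed by the drawing. -/
def Crossed (ε : (ℤ × ℤ) × Bool) : Prop :=
  (∃ e, D.r e = ε) ∨ ∃ i, ε.1 ∈ D.S i ∧ top ε ∈ D.S i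

/-- Faces in the same region of the complement of the drawing. -/
def regions : Setoid (ℤ × ℤ) :=
  Relation.EqvGen.setoid fun F G => ∃ ε, ¬ D.Crossed ε ∧ F = ε.1 ∧ G = face ε

lemma region_eq {ε : (ℤ × ℤ) × Bool} (h : ¬ D.Crossed ε) :
    (Quotient.mk D.regions ε.1) = Quotient.mk D.regions (face ε) :=
  Quotient.sound (Relation.EqvGen.rel _ _ ⟨ε, h, rfl, rfl⟩)

section

open Classical in
/-- The boundary modulo two of a region. -/
noncomputable def bd (ρ : Quotient D.regions) (e : E) : ZMod 2 :=
  (if Quotient.mk D.regions (D.r e).1 = ρ then 1 else 0) +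
    (if Quotient.mk D.regions (face (D.r e)) = ρ then 1 else 0)

open Classical in
/-- The boundary map of the graph, modulo two. -/
noncomputable def boundary [Fintype E] : (E → ZMod 2) →ₗ[ZMod 2] (ι → ZMod 2) where
  toFun z i := ∑ e, z e * ((if D.src e = i then 1 else 0) + (if D.tgt e = i then 1 else 0))
  map_add' z w := by
    ext i; simp only [Pi.add_apply, add_mul, Finset.sum_add_distrib]
  map_smul' c z := by
    ext i; simp only [Pi.smul_apply, smul_eq_mul, Finset.mul_sum, RingHom.id_apply, mul_assoc]

lemma boundary_apply [Fintype E] [DecidableEq ι] (z : E → ZMod 2) (i : ι) : D.boundary z i =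
    ∑ e, z e * ((if D.src e = i then 1 else 0) + (if D.tgt e = i then 1 else 0)) := by
  simp only [boundary, LinearMap.coe_mk, AddHom.coe_mk]
  congr!

/-- The jumps of the indicator function of `ρ` are summed over the edges leaving `S i`. Uncrossed
edges have no jump and edges inside a vertex set count zero or two times, so only the edges `D.r e`
contribute. -/
lemma boundary_bd [Fintype E] (ρ : Quotient D.regions) : D.boundary (D.bd ρ) = 0 := by
  classical
  ext i
  set g : ℤ × ℤ → ZMod 2 := fun F => if Quotient.mk D.regions F = ρ then 1 else 0 with hg
  let B : Finset ((ℤ × ℤ) × Bool) := (D.S i) ×ˢ Finset.univ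
  let B' : Finset ((ℤ × ℤ) × Bool) := ((D.S i) ×ˢ Finset.univ).image
    fun x => (if x.2 then (x.1.1, x.1.2 - 1) else (x.1.1 - 1, x.1.2), x.2)
  let K := B ∪ B' ∪ Finset.univ.image D.r
  have hK : ∀ ε : (ℤ × ℤ) × Bool, ε.1 ∈ D.S i ∨ top ε ∈ D.S i → ε ∈ K := by
    rintro ε (h | h)
    · simp [K, B, h]
    · have : ε ∈ B' := by
        refine Finset.mem_image.2 ⟨(top ε, ε.2), by simpa using h, ?_⟩
        obtain ⟨⟨x, y⟩, b⟩ := ε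
        cases b <;> simp [top]
      simp [K, this]
  have key := sum_jump_eq_zero g (D.S i) K hK
  have hsub : Finset.univ.image D.r ⊆ K := Finset.subset_union_right
  rw [← Finset.sum_subset hsub, Finset.sum_image fun _ _ _ _ h => D.r_injective h] at key
  · simp only [D.src_mem_iff, D.tgt_mem_iff] at key
    rw [D.boundary_apply]
    exact key
  · intro ε _ hε
    by_cases hc : D.Crossed ε
    · rcases hc with ⟨e, rfl⟩ | ⟨j, h1, h2⟩
      · exact absurd (Finset.mem_image_of_mem _ (Finset.mem_univ e)) hε
      · by_cases hj : j = i
        · subst hj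
          rw [if_pos h1, if_pos h2, CharTwo.add_self_eq_zero, mul_zero]
        · rw [if_neg fun h => hj (D.disj h1 h), if_neg fun h => hj (D.disj h2 h)]
          simp
    · rw [show g (face ε) = g ε.1 by simp only [hg, D.region_eq hc],
        CharTwo.add_self_eq_zero, zero_mul]

/-- The edge is lengthened to a path between base points through the two vertex sets, which adds no
other edge of the drawing. All chains then have their rays at base points, where they can cancel. -/
lemma exists_edge_chain (e : E) : ∃ f μ, Chain {v | ∃ i, v ∈ D.S i} (D.base (D.src e))
    (D.base (D.tgt e)) f μ ∧ (∀ ε, ¬ D.Crossed ε → μ ε = 0) ∧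
      ∀ e', μ (D.r e') = if D.r e' = D.r e then 1 else 0 := by
  obtain ⟨f, μ, hf, hμ⟩ := exists_chain (D.conn (D.r_src e))
  obtain ⟨f', μ', hf', hμ'⟩ := exists_chain (D.conn (D.r_tgt e))
  have aux : ∀ {i : ι} {μ : (ℤ × ℤ) × Bool → ZMod 2},
      (∀ ε, μ ε ≠ 0 → ε.1 ∈ D.S i ∧ top ε ∈ D.S i) → ∀ e', μ (D.r e') = 0 := by
    intro i μ hμ e'
    by_contra h
    exact D.ne e' ((D.disj (D.r_src e') (hμ _ h).1).trans (D.disj (D.r_tgt e') (hμ _ h).2).symm)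
  have aux' : ∀ {i : ι} {μ : (ℤ × ℤ) × Bool → ZMod 2},
      (∀ ε, μ ε ≠ 0 → ε.1 ∈ D.S i ∧ top ε ∈ D.S i) → ∀ ε, ¬ D.Crossed ε → μ ε = 0 := by
    intro i μ hμ ε hε
    by_contra h
    exact hε (Or.inr ⟨i, hμ _ h⟩)
  refine ⟨f + f' + cut (D.r e), μ + μ' + Pi.single (D.r e) 1, ⟨fun η => ?_, fun η hη => ?_⟩,
    fun ε hε => ?_, fun e' => ?_⟩
  · have h1 := hf η
    have h2 := hf' η
    have h3 := cut_add_cut (D.r e) η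
    simp only [Pi.add_apply, Pi.single_apply]
    linear_combination h1 + h2 + h3 + CharTwo.add_self_eq_zero (ray η (D.r e).1) +
      CharTwo.add_self_eq_zero (ray η (top (D.r e)))
  · by_cases h : η = D.r e
    · subst h
      exact ⟨⟨_, D.r_src e⟩, ⟨_, D.r_tgt e⟩⟩
    · by_cases h1 : μ η = 0
      · by_cases h2 : μ' η = 0
        · simp [h, h1, h2] at hη
        · exact ⟨⟨_, (hμ' _ h2).1⟩, ⟨_, (hμ' _ h2).2⟩⟩
      · exact ⟨⟨_, (hμ _ h1).1⟩, ⟨_, (hμ _ h1).2⟩⟩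
  · have : ε ≠ D.r e := by
      rintro rfl
      exact hε (Or.inl ⟨e, rfl⟩)
    simp [aux' hμ ε hε, aux' hμ' ε hε, this]
  · simp [aux hμ e', aux hμ' e', Pi.single_apply]

/-- The face functions of the edges are superposed with weights `z`. The sum is constant on regions
and jumps by `z e` across `D.r e`, so its values are the coefficients `w`. -/
lemma mem_span_bd [Fintype E] {z : E → ZMod 2} (hz : D.boundary z = 0) :
    ∃ w : Quotient D.regions → ZMod 2, ∀ e,
      z e = w (Quotient.mk D.regions (D.r e).1) + w (Quotient.mk D.regions (face (D.r e))) := by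
  classical
  choose f μ hc hμ hr using D.exists_edge_chain
  have jump : ∀ ε, ∑ e, z e * f e ε.1 + ∑ e, z e * f e (face ε) = ∑ e, z e * μ e ε := by
    intro ε
    rw [← Finset.sum_add_distrib]
    have h1 : ∀ e, z e * f e ε.1 + z e * f e (face ε) = z e * μ e ε +
        z e * (ray ε (D.base (D.src e)) + ray ε (D.base (D.tgt e))) := fun e => by
      linear_combination z e * (hc e).1 ε
    rw [Finset.sum_congr rfl fun e _ => h1 e, Finset.sum_add_distrib, add_eq_left]
    let T : Finset ι := Finset.univ.image D.src ∪ Finset.univ.image D.tgt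
    -- Regrouped by vertices, the ray from the base point of `i` has coefficient `D.boundary z i`,
    -- which is zero.
    have h2 : ∀ e, z e * (ray ε (D.base (D.src e)) + ray ε (D.base (D.tgt e))) =
        ∑ i ∈ T, ray ε (D.base i) *
          (z e * ((if D.src e = i then 1 else 0) + (if D.tgt e = i then 1 else 0))) := by
      intro e
      have hs : D.src e ∈ T := by simp [T]
      have ht : D.tgt e ∈ T := by simp [T]
      simp only [mul_add, mul_ite, mul_one, mul_zero, Finset.sum_add_distrib,
        Finset.sum_ite_eq, hs, ht, if_true]
      ring
    rw [Finset.sum_congr rfl fun e _ => h2 e, Finset.sum_comm]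
    refine Finset.sum_eq_zero fun i _ => ?_
    rw [← Finset.mul_sum]
    have : D.boundary z i = 0 := by rw [hz]; rfl
    rw [show (∑ e, z e * ((if D.src e = i then 1 else 0) + (if D.tgt e = i then 1 else 0))) = 0
      from this, mul_zero]
  have hw : ∀ F G, D.regions F G → ∑ e, z e * f e F = ∑ e, z e * f e G := by
    intro F G h
    induction h with
    | rel F G h =>
      obtain ⟨ε, hε, rfl, rfl⟩ := h
      have := jump ε
      rw [Finset.sum_eq_zero (f := fun e => z e * μ e ε) fun e _ => by rw [hμ e ε hε, mul_zero],
        CharTwo.add_eq_zero] at this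
      exact this
    | refl => rfl
    | symm _ _ _ ih => exact ih.symm
    | trans _ _ _ _ _ ih1 ih2 => exact ih1.trans ih2
  refine ⟨Quotient.lift (fun F => ∑ e, z e * f e F) hw, fun e => ?_⟩
  have := jump (D.r e)
  simp only [hr, D.r_injective.eq_iff, mul_ite, mul_one, mul_zero, Finset.sum_ite_eq, Finset.mem_univ, if_true] at this
  exact this.symm

/-- Rank and nullity: boundaries have coordinate sum zero, so the rank is at most the number of
vertices minus one. -/
lemma card_add_one_le [Fintype E] [Fintype ι] [Nonempty ι] :
    Fintype.card E + 1 ≤ Module.finrank (ZMod 2) (LinearMap.ker D.boundary) + Fintype.card ι := by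
  classical
  have h1 := LinearMap.finrank_range_add_finrank_ker D.boundary
  rw [Module.finrank_fintype_fun_eq_card] at h1
  let σ : (ι → ZMod 2) →ₗ[ZMod 2] ZMod 2 := ∑ i, LinearMap.proj i
  have hσ : ∀ x, σ x = ∑ i, x i := fun x => by simp [σ]
  have h2 := LinearMap.finrank_range_add_finrank_ker σ
  rw [Module.finrank_fintype_fun_eq_card] at h2
  have h3 : LinearMap.range D.boundary ≤ LinearMap.ker σ := by
    rintro _ ⟨z, rfl⟩
    rw [LinearMap.mem_ker, hσ]
    change ∑ i, ∑ e, z e * ((if D.src e = i then 1 else 0) + (if D.tgt e = i then 1 else 0)) = 0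
    rw [Finset.sum_comm]
    refine Finset.sum_eq_zero fun e _ => ?_
    rw [← Finset.mul_sum, Finset.sum_add_distrib]
    simp [CharTwo.add_self_eq_zero]
  have h4 : Module.finrank (ZMod 2) (LinearMap.range σ) = 1 := by
    rw [LinearMap.range_eq_top.2, finrank_top, Module.finrank_self]
    intro c
    obtain ⟨i⟩ := ‹Nonempty ι›
    exact ⟨Pi.single i c, by simp [hσ]⟩
  have h5 := Submodule.finrank_mono h3
  omega

/-- A cycle modulo two in a simple graph has at least three edges. -/
lemma three_le_card_support [Fintype E] {z : E → ZMod 2} (hz : D.boundary z = 0) (h0 : z ≠ 0) :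
    3 ≤ (Finset.univ.filter fun e => z e ≠ 0).card := by
  classical
  obtain ⟨e, he⟩ := Function.ne_iff.1 h0
  have key : ∀ i, (D.src e = i ∨ D.tgt e = i) →
      ∃ e', e' ≠ e ∧ z e' ≠ 0 ∧ (D.src e' = i ∨ D.tgt e' = i) := by
    intro i hi
    by_contra! hcon
    have h1 : ∑ e', z e' * ((if D.src e' = i then 1 else 0) + (if D.tgt e' = i then 1 else 0))
        = 0 := congrFun hz i
    rw [Finset.sum_eq_single e] at h1
    · rcases hi with hi | hi
      · have : D.tgt e ≠ i := fun h => D.ne e (hi.trans h.symm)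
        simp [hi, this] at h1
        exact he h1
      · have : D.src e ≠ i := fun h => D.ne e (h.trans hi.symm)
        simp [hi, this] at h1
        exact he h1
    · intro e' _ hne
      by_cases hz' : z e' = 0
      · simp [hz']
      · obtain ⟨h1, h2⟩ := hcon e' hne hz'
        simp [h1, h2]
    · simp
  obtain ⟨e₁, hne₁, hz₁, hi₁⟩ := key _ (Or.inl rfl)
  obtain ⟨e₂, hne₂, hz₂, hi₂⟩ := key _ (Or.inr rfl)
  have h12 : e₁ ≠ e₂ := by
    rintro rfl
    have := D.ne e
    rcases hi₁ with h | h <;> rcases hi₂ with h' | h'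
    · exact this (h.symm.trans h')
    · exact hne₁ (D.inj h h')
    · exact hne₁ (D.inj' h' h)
    · exact this (h.symm.trans h')
  have : ({e, e₁, e₂} : Finset E) ⊆ Finset.univ.filter fun e => z e ≠ 0 := by
    intro x hx
    simp only [Finset.mem_insert, Finset.mem_singleton] at hx
    rcases hx with rfl | rfl | rfl
    exacts [by simpa using he, by simpa using hz₁, by simpa using hz₂]
  calc 3 = ({e, e₁, e₂} : Finset E).card := by
        rw [Finset.card_insert_of_notMem, Finset.card_pair h12]
        simp [hne₁.symm, hne₂.symm]
    _ ≤ _ := Finset.card_le_card this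

/-- A planar simple graph with `n` vertices has at most `3 n - 3` edges. -/
theorem card_edges_add_three_le (D : Drawing ι E) [Fintype E] [Fintype ι] [Nonempty ι] :
    Fintype.card E + 3 ≤ 3 * Fintype.card ι := by
  classical
  -- Only the finitely many regions next to an edge of the drawing can have nonzero boundary.
  let P : Finset (Quotient D.regions) :=
    Finset.univ.image (fun e => Quotient.mk D.regions (D.r e).1) ∪
      Finset.univ.image fun e => Quotient.mk D.regions (face (D.r e))
  let Q := P.filter fun ρ => D.bd ρ ≠ 0
  have hspan : LinearMap.ker D.boundary ≤ Submodule.span (ZMod 2) ↑(Q.image D.bd) := by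
    intro z hz
    obtain ⟨w, hw⟩ := D.mem_span_bd hz
    have : z = ∑ ρ ∈ P, w ρ • D.bd ρ := by
      ext e
      have h1 : Quotient.mk D.regions (D.r e).1 ∈ P := by simp [P]
      have h2 : Quotient.mk D.regions (face (D.r e)) ∈ P := by simp [P]
      rw [hw e]
      simp [bd, mul_add, Finset.sum_add_distrib, h1, h2]
    rw [this]
    refine Submodule.sum_mem _ fun ρ hρ => Submodule.smul_mem _ _ ?_
    by_cases h0 : D.bd ρ = 0
    · rw [h0]
      exact Submodule.zero_mem _
    · exact Submodule.subset_span
        (Finset.mem_image_of_mem _ (Finset.mem_filter.2 ⟨hρ, h0⟩))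
  have hrank : Module.finrank (ZMod 2) (LinearMap.ker D.boundary) ≤ Q.card :=
    (Submodule.finrank_mono hspan).trans
      ((finrank_span_finset_le_card _).trans Finset.card_image_le)
  have hsupp : ∑ ρ ∈ Q, (Finset.univ.filter fun e => D.bd ρ e ≠ 0).card ≤
      2 * Fintype.card E := by
    simp only [Finset.card_filter]
    rw [Finset.sum_comm, mul_comm, ← smul_eq_mul, ← Finset.card_univ, ← Finset.sum_const]
    refine Finset.sum_le_sum fun e _ => ?_
    rw [← Finset.card_filter]
    have : (Q.filter fun ρ => D.bd ρ e ≠ 0) ⊆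
        {Quotient.mk D.regions (D.r e).1, Quotient.mk D.regions (face (D.r e))} := by
      intro ρ hρ
      have := (Finset.mem_filter.1 hρ).2
      by_contra hcon
      simp only [Finset.mem_insert, Finset.mem_singleton, not_or] at hcon
      exact this (by simp [bd, Ne.symm hcon.1, Ne.symm hcon.2])
    exact (Finset.card_le_card this).trans Finset.card_le_two
  have h3 : Q.card * 3 ≤ ∑ ρ ∈ Q, (Finset.univ.filter fun e => D.bd ρ e ≠ 0).card := by
    rw [← smul_eq_mul, ← Finset.sum_const]
    exact Finset.sum_le_sum fun ρ hρ =>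
      D.three_le_card_support (D.boundary_bd ρ) (Finset.mem_filter.1 hρ).2
  have h1 := D.card_add_one_le
  omega

end

end Drawing

end Grid

/-! ### Paths on fine grids inside connected open sets. -/

namespace Grid

/-- Grid steps inside a set. -/
def StepIn (Q : Set (ℤ × ℤ)) (p q : ℤ × ℤ) : Prop := Step p q ∧ p ∈ Q ∧ q ∈ Q

lemma StepIn.mono {Q R : Set (ℤ × ℤ)} (h : Q ⊆ R) {p q : ℤ × ℤ} (hs : StepIn Q p q) :
    StepIn R p q := ⟨hs.1, h hs.2.1, h hs.2.2⟩

lemma reach_mono {Q R : Set (ℤ × ℤ)} (h : Q ⊆ R) {p q : ℤ × ℤ}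
    (hs : Relation.ReflTransGen (StepIn Q) p q) : Relation.ReflTransGen (StepIn R) p q :=
  Relation.ReflTransGen.mono (p := StepIn R) (fun _ _ hs => StepIn.mono h hs) _ _ hs

lemma reach_symm {Q : Set (ℤ × ℤ)} {p q : ℤ × ℤ} (hs : Relation.ReflTransGen (StepIn Q) p q) :
    Relation.ReflTransGen (StepIn Q) q p := by
  induction hs with
  | refl => exact .refl
  | tail _ h ih => exact .head ⟨h.1.symm, h.2.2, h.2.1⟩ ih

lemma reach_of_ordConnected {Q : Set (ℤ × ℤ)} (hQ : ∀ p ∈ Q, ∀ q ∈ Q, ∀ a ∈ Set.uIcc p.1 q.1,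
    ∀ b ∈ Set.uIcc p.2 q.2, (a, b) ∈ Q) {p q : ℤ × ℤ} (hp : p ∈ Q) (hq : q ∈ Q) :
    Relation.ReflTransGen (StepIn Q) p q := by
  have hor : ∀ b a a' : ℤ, a ≤ a' → (a, b) ∈ Q → (a', b) ∈ Q →
      Relation.ReflTransGen (StepIn Q) (a, b) (a', b) := by
    intro b a a' h
    induction a', h using Int.leInduction with
    | base => exact fun _ _ => .refl
    | succ n hn ih =>
      intro h1 h2
      have h3 : (n, b) ∈ Q := hQ _ h1 _ h2 n (Set.mem_uIcc.2 (Or.inl ⟨hn, by simp⟩)) b (by simp)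
      exact (ih h1 h3).tail ⟨⟨((n, b), false), Or.inl ⟨rfl, by simp [top]⟩⟩, h3, h2⟩
  have ver : ∀ a b b' : ℤ, b ≤ b' → (a, b) ∈ Q → (a, b') ∈ Q →
      Relation.ReflTransGen (StepIn Q) (a, b) (a, b') := by
    intro a b b' h
    induction b', h using Int.leInduction with
    | base => exact fun _ _ => .refl
    | succ n hn ih =>
      intro h1 h2
      have h3 : (a, n) ∈ Q := hQ _ h1 _ h2 a (by simp) n (Set.mem_uIcc.2 (Or.inl ⟨hn, by simp⟩))
      exact (ih h1 h3).tail ⟨⟨((a, n), true), Or.inl ⟨rfl, by simp [top]⟩⟩, h3, h2⟩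
  -- The path is L-shaped with this corner.
  have hm : (q.1, p.2) ∈ Q := hQ p hp q hq _ (by simp) _ (by simp)
  refine Relation.ReflTransGen.trans (b := (q.1, p.2)) ?_ ?_
  · rcases le_total p.1 q.1 with h | h
    exacts [hor _ _ _ h hp hm, reach_symm (hor _ _ _ h hm hp)]
  · rcases le_total p.2 q.2 with h | h
    exacts [ver _ _ _ h hm hq, reach_symm (ver _ _ _ h hq hm)]

/-- A grid path either avoids a set `T`, or has a finite connected initial part next to `T`. -/
lemma exists_finset_of_reach {Q T : Set (ℤ × ℤ)} {s t : ℤ × ℤ}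
    (h : Relation.ReflTransGen (StepIn Q) s t) (hs : s ∈ Q) (hT : s ∉ T) :
    ∃ F : Finset (ℤ × ℤ), s ∈ F ∧ (F : Set (ℤ × ℤ)) ⊆ Q \ T ∧
      (∀ w ∈ F, Relation.ReflTransGen (StepIn F) s w) ∧
      (t ∈ F ∨ ∃ u ∈ F, ∃ v ∈ T, Step u v) := by
  classical
  induction h with
  | refl => exact ⟨{s}, by simp, by simp [hs, hT], by simp [Relation.ReflTransGen.refl], by simp⟩
  | @tail b c _ hbc ih =>
    obtain ⟨F, h1, h2, h3, h4⟩ := ih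
    rcases h4 with h4 | h4
    · by_cases hc : c ∈ T
      · exact ⟨F, h1, h2, h3, Or.inr ⟨b, h4, c, hc, hbc.1⟩⟩
      · have hF : (F : Set (ℤ × ℤ)) ⊆ ↑(insert c F) := by simp
        refine ⟨insert c F, by simp [h1], ?_, ?_, by simp⟩
        · rw [Finset.coe_insert]
          exact Set.insert_subset ⟨hbc.2.2, hc⟩ h2
        · intro w hw
          rcases Finset.mem_insert.1 hw with rfl | hw
          · exact (reach_mono hF (h3 b h4)).tail ⟨hbc.1, hF h4, by simp⟩
          · exact reach_mono hF (h3 w hw)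
    · exact ⟨F, h1, h2, h3, Or.inr h4⟩

/-- The point of the plane at the vertex `v` of the grid of mesh `δ`. -/
def pt (δ : ℝ) (v : ℤ × ℤ) : ℝ × ℝ := (δ * v.1, δ * v.2)

/-- A grid vertex close to a given point. -/
noncomputable def near (δ : ℝ) (x : ℝ × ℝ) : ℤ × ℤ := (⌊x.1 / δ⌋, ⌊x.2 / δ⌋)

lemma dist_pt_near_le {δ : ℝ} (hδ : 0 < δ) (x : ℝ × ℝ) : dist (pt δ (near δ x)) x ≤ δ := by
  have h : ∀ y : ℝ, dist (δ * ⌊y / δ⌋) y ≤ δ := by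
    intro y
    have h1 := Int.floor_le (y / δ)
    have h2 := Int.lt_floor_add_one (y / δ)
    rw [le_div_iff₀ hδ] at h1
    rw [div_lt_iff₀ hδ] at h2
    rw [Real.dist_eq, abs_le]
    constructor <;> nlinarith
  rw [Prod.dist_eq]
  exact max_le (h _) (h _)

lemma eventually_near_mem {U : Set (ℝ × ℝ)} (hU : IsOpen U) {x : ℝ × ℝ} (hx : x ∈ U) :
    ∀ᶠ δ in 𝓝[>] (0 : ℝ), pt δ (near δ x) ∈ U := by
  obtain ⟨r, hr, hU⟩ := Metric.isOpen_iff.1 hU x hx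
  filter_upwards [Ioo_mem_nhdsGT hr] with δ hδ
  exact hU (Metric.mem_ball.2 ((dist_pt_near_le hδ.1 x).trans_lt hδ.2))

/-- Balls of `ℝ × ℝ` in the product metric are squares, so their grid vertices form a rectangular
block. -/
lemma reach_ball {δ : ℝ} (hδ : 0 < δ) {c : ℝ × ℝ} {r : ℝ} {p q : ℤ × ℤ}
    (hp : pt δ p ∈ Metric.ball c r) (hq : pt δ q ∈ Metric.ball c r) :
    Relation.ReflTransGen (StepIn (pt δ ⁻¹' Metric.ball c r)) p q := by
  have key : ∀ {a b x : ℤ} {y : ℝ}, dist (δ * a) y < r → dist (δ * b) y < r → x ∈ Set.uIcc a b →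
      dist (δ * x) y < r := by
    intro a b x y ha hb hx
    rw [Real.dist_eq, abs_lt] at *
    rcases Set.mem_uIcc.1 hx with ⟨h1, h2⟩ | ⟨h1, h2⟩ <;>
    · have h1' := mul_le_mul_of_nonneg_left (Int.cast_le (R := ℝ).2 h1) hδ.le
      have h2' := mul_le_mul_of_nonneg_left (Int.cast_le (R := ℝ).2 h2) hδ.le
      constructor <;> linarith
  refine reach_of_ordConnected ?_ hp hq
  intro p hp q hq a ha b hb
  simp only [Set.mem_preimage, Metric.mem_ball, Prod.dist_eq, pt, max_lt_iff] at *
  exact ⟨key hp.1 hq.1 ha, key hp.2 hq.2 hb⟩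

/-- Being joined in `U` by grid paths for all small meshes is symmetric and transitive, and holds
locally by `reach_ball`; connectedness does the rest. -/
lemma eventually_reach {U : Set (ℝ × ℝ)} (hU : IsOpen U) (hc : IsPreconnected U) {x y : ℝ × ℝ}
    (hx : x ∈ U) (hy : y ∈ U) :
    ∀ᶠ δ in 𝓝[>] (0 : ℝ), Relation.ReflTransGen (StepIn (pt δ ⁻¹' U)) (near δ x) (near δ y) := by
  refine hc.induction₂ (fun x y => ∀ᶠ δ in 𝓝[>] (0 : ℝ),
    Relation.ReflTransGen (StepIn (pt δ ⁻¹' U)) (near δ x) (near δ y)) ?_ ?_ ?_ hx hy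
  · intro x hx
    obtain ⟨r, hr, hr'⟩ := Metric.isOpen_iff.1 hU x hx
    refine eventually_nhdsWithin_of_eventually_nhds ?_
    filter_upwards [Metric.ball_mem_nhds x hr] with y hy
    filter_upwards [eventually_near_mem Metric.isOpen_ball (Metric.mem_ball_self hr),
      eventually_near_mem Metric.isOpen_ball hy, self_mem_nhdsWithin] with δ h1 h2 hδ
    exact reach_mono (Set.preimage_mono hr') (reach_ball hδ h1 h2)
  · intro x y z _ _ _ h1 h2
    filter_upwards [h1, h2] with δ h1 h2 using h1.trans h2
  · intro x y _ _ h
    filter_upwards [h] with δ h using reach_symm h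

end Grid

namespace Grid

/-- A connected open set contains finite connected sets of grid vertices that are close to
finitely many given points, as soon as the mesh is small. -/
lemma eventually_exists_finset {E : Type*} [Finite E] {U : Set (ℝ × ℝ)} (hU : IsOpen U)
    (hc : IsPreconnected U) {x : ℝ × ℝ} (hx : x ∈ U) (y : E → ℝ × ℝ) (hy : ∀ e, y e ∈ U) :
    ∀ᶠ δ in 𝓝[>] (0 : ℝ), ∃ F : Finset (ℤ × ℤ), near δ x ∈ F ∧ (∀ e, near δ (y e) ∈ F) ∧
      (F : Set (ℤ × ℤ)) ⊆ pt δ ⁻¹' U ∧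
      ∀ w ∈ F, Relation.ReflTransGen (StepIn F) (near δ x) w := by
  classical
  have := Fintype.ofFinite E
  filter_upwards [eventually_near_mem hU hx,
    eventually_all.2 fun e => eventually_reach hU hc hx (hy e)] with δ h1 h2
  have h3 : ∀ e, ∃ F : Finset (ℤ × ℤ), near δ x ∈ F ∧ (F : Set (ℤ × ℤ)) ⊆ pt δ ⁻¹' U ∧
      (∀ w ∈ F, Relation.ReflTransGen (StepIn F) (near δ x) w) ∧ near δ (y e) ∈ F := by
    intro e
    obtain ⟨F, hF1, hF2, hF3, hF4⟩ := exists_finset_of_reach (T := ∅) (h2 e) h1 (by simp)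
    refine ⟨F, hF1, hF2.trans Set.sdiff_subset, hF3, hF4.resolve_right ?_⟩
    rintro ⟨_, _, _, h, _⟩
    exact h
  choose F hF1 hF2 hF3 hF4 using h3
  refine ⟨{near δ x} ∪ Finset.univ.biUnion F, by simp, fun e => ?_, ?_, ?_⟩
  · exact Finset.mem_union_right _ (Finset.mem_biUnion.2 ⟨e, Finset.mem_univ e, hF4 e⟩)
  · intro w hw
    simp only [Finset.coe_union, Finset.coe_singleton, Set.mem_union, Set.mem_singleton_iff,
      Finset.mem_coe, Finset.mem_biUnion, Finset.mem_univ, true_and] at hw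
    rcases hw with rfl | ⟨e, he⟩
    exacts [h1, hF2 e he]
  · intro w hw
    simp only [Finset.mem_union, Finset.mem_singleton, Finset.mem_biUnion, Finset.mem_univ,
      true_and] at hw
    rcases hw with rfl | ⟨e, he⟩
    · exact .refl
    · refine reach_mono ?_ (hF3 e w he)
      intro v hv
      exact Finset.mem_coe.2 (Finset.mem_union_right _
        (Finset.mem_biUnion.2 ⟨e, Finset.mem_univ e, hv⟩))

end Grid

/-! ### The edge bound for connected open sets in the plane and on the sphere. -/

/-- Disjoint connected open sets in the plane: there are at most `3 n - 3` pairs with a common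
boundary point that is not on the boundary of the other sets. -/
theorem card_edgeFinset_add_three_le_of_plane {ι : Type*} [Fintype ι] [Nonempty ι]
    (U : ι → Set (ℝ × ℝ)) (hU : ∀ i, IsOpen (U i)) (hc : ∀ i, IsConnected (U i))
    (hd : Pairwise fun i j => Disjoint (U i) (U j)) (G : SimpleGraph ι) [Fintype G.edgeSet]
    (hG : ∀ i j, G.Adj i j → ∃ p ∈ closure (U i), p ∈ closure (U j) ∧
      ∀ k, k ≠ i → k ≠ j → p ∉ closure (U k)) :
    G.edgeFinset.card + 3 ≤ 3 * Fintype.card ι := by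
  classical
  have hE : ∀ e : G.edgeSet, ∃ i j p, e.1 = s(i, j) ∧ i ≠ j ∧ p ∈ closure (U i) ∧
      p ∈ closure (U j) ∧ ∀ k, k ≠ i → k ≠ j → p ∉ closure (U k) := by
    rintro ⟨e, he⟩
    induction e with | _ i j =>
    obtain ⟨p, h⟩ := hG i j he
    exact ⟨i, j, p, rfl, G.ne_of_adj he, h⟩
  choose src tgt p hst hne hp1 hp2 hp3 using hE
  -- A contact point lies in the closures of exactly two of the sets, so it determines its edge.
  have hpinj : ∀ e e', p e = p e' → e = e' := by
    intro e e' h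
    have h1 : src e = src e' ∨ src e = tgt e' := by
      by_contra! hh
      exact hp3 e' (src e) hh.1 hh.2 (h ▸ hp1 e)
    have h2 : tgt e = src e' ∨ tgt e = tgt e' := by
      by_contra! hh
      exact hp3 e' (tgt e) hh.1 hh.2 (h ▸ hp2 e)
    apply Subtype.ext
    rw [hst, hst, Sym2.eq_iff]
    have := hne e
    grind
  obtain ⟨r, hr, hr1, hr2⟩ : ∃ r > 0, (∀ e k, k ≠ src e → k ≠ tgt e →
      Disjoint (Metric.ball (p e) r) (U k)) ∧
      ∀ e e', e ≠ e' → Disjoint (Metric.ball (p e) r) (Metric.ball (p e') r) := by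
    have h1 : ∀ᶠ r in 𝓝[>] (0 : ℝ), ∀ e k, k ≠ src e → k ≠ tgt e →
        Disjoint (Metric.ball (p e) r) (U k) := by
      refine eventually_all.2 fun e => eventually_all.2 fun k => ?_
      by_cases h : k ≠ src e ∧ k ≠ tgt e
      · obtain ⟨r, hr, hb⟩ := Metric.isOpen_iff.1 isClosed_closure.isOpen_compl (p e)
          (hp3 e k h.1 h.2)
        filter_upwards [Ioo_mem_nhdsGT hr] with s hs _ _
        refine Set.disjoint_left.2 fun x hx hxU => ?_
        exact hb (Metric.ball_subset_ball hs.2.le hx) (subset_closure hxU)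
      · filter_upwards with s h1 h2 using absurd ⟨h1, h2⟩ h
    have h2 : ∀ᶠ r in 𝓝[>] (0 : ℝ), ∀ e e', e ≠ e' →
        Disjoint (Metric.ball (p e) r) (Metric.ball (p e') r) := by
      refine eventually_all.2 fun e => eventually_all.2 fun e' => ?_
      by_cases h : e = e'
      · filter_upwards with s h' using absurd h h'
      · have : 0 < dist (p e) (p e') := dist_pos.2 fun h' => h (hpinj e e' h')
        filter_upwards [Ioo_mem_nhdsGT (half_pos this)] with s hs _
        exact Metric.ball_disjoint_ball (by linarith [hs.2])
    obtain ⟨r, ⟨h1, h2⟩, h3⟩ := ((h1.and h2).and self_mem_nhdsWithin).exists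
    exact ⟨r, h3, h1, h2⟩
  have hab : ∀ e, ∃ a b, (a ∈ U (src e) ∧ a ∈ Metric.ball (p e) r) ∧
      b ∈ U (tgt e) ∧ b ∈ Metric.ball (p e) r := by
    intro e
    obtain ⟨a, h1, h2⟩ := mem_closure_iff.1 (hp1 e) _ Metric.isOpen_ball (Metric.mem_ball_self hr)
    obtain ⟨b, h3, h4⟩ := mem_closure_iff.1 (hp2 e) _ Metric.isOpen_ball (Metric.mem_ball_self hr)
    exact ⟨a, b, ⟨h2, h1⟩, h4, h3⟩
  choose a b ha hb using hab
  choose x hx using fun i => (hc i).nonempty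
  -- The skeleton `T i` of `U i` has to pass near the chosen point of `U i` close to each contact
  -- point of `i`.
  let y : ∀ i, {e : G.edgeSet // src e = i ∨ tgt e = i} → ℝ × ℝ :=
    fun i e => if src e.1 = i then a e.1 else b e.1
  have hy : ∀ i e, y i e ∈ U i := by
    rintro i ⟨e, he⟩
    by_cases h : src e = i
    · subst h
      simpa [y] using (ha e).1
    · obtain rfl := he.resolve_left h
      simpa [y, h] using (hb e).1
  obtain ⟨δ, hδ⟩ := ((eventually_all.2 fun i => Grid.eventually_exists_finset (hU i)
    (hc i).isPreconnected (hx i) (y i) (hy i)).and ((eventually_all.2 fun e =>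
      (Grid.eventually_near_mem Metric.isOpen_ball (ha e).2).and
      ((Grid.eventually_near_mem Metric.isOpen_ball (hb e).2).and
      (Grid.eventually_near_mem (hU _) (ha e).1))).and self_mem_nhdsWithin)).exists
  obtain ⟨hT, hδ', hδ0⟩ := hδ
  choose T hT1 hT2 hT3 hT4 using hT
  have hTd : ∀ {i j v}, v ∈ T i → Grid.pt δ v ∈ U j → i = j := by
    intro i j v h1 h2
    by_contra h
    exact Set.disjoint_left.1 (hd h) (hT3 i h1) h2
  have haT : ∀ e, Grid.near δ (a e) ∈ T (src e) := fun e => by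
    simpa [y] using hT2 (src e) ⟨e, Or.inl rfl⟩
  have hbT : ∀ e, Grid.near δ (b e) ∈ T (tgt e) := fun e => by
    simpa [y, hne e] using hT2 (tgt e) ⟨e, Or.inr rfl⟩
  -- The tentacle `F e` runs inside the ball around `p e` from the source skeleton and stops one
  -- step before the target skeleton. It need not stay inside the two sets; it only has to avoid the
  -- other skeletons and tentacles.
  have hF : ∀ e, ∃ F : Finset (ℤ × ℤ), Grid.near δ (a e) ∈ F ∧
      (F : Set (ℤ × ℤ)) ⊆ (Grid.pt δ ⁻¹' Metric.ball (p e) r) \ T (tgt e) ∧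
      (∀ w ∈ F, Relation.ReflTransGen (Grid.StepIn F) (Grid.near δ (a e)) w) ∧
      ∃ u ∈ F, ∃ v ∈ T (tgt e), Grid.Step u v := by
    intro e
    obtain ⟨F, h1, h2, h3, h4⟩ := Grid.exists_finset_of_reach (T := T (tgt e))
      (Grid.reach_ball hδ0 (hδ' e).1 (hδ' e).2.1) (hδ' e).1
      (fun h => hne e (hTd h (hδ' e).2.2).symm)
    exact ⟨F, h1, h2, h3, h4.resolve_left fun h => (h2 h).2 (hbT e)⟩
  choose F hF1 hF2 hF3 hF4 using hF
  let S : ι → Finset (ℤ × ℤ) := fun i =>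
    T i ∪ (Finset.univ.filter fun e => src e = i).biUnion F
  have hS : ∀ {i v}, v ∈ S i ↔ v ∈ T i ∨ ∃ e, src e = i ∧ v ∈ F e := by
    intro i v
    simp [S]
  have hTF : ∀ {i e v}, v ∈ T i → v ∈ F e → i = src e := by
    intro i e v h1 h2
    by_contra h
    by_cases h' : i = tgt e
    · subst h'
      exact (hF2 e h2).2 h1
    · exact Set.disjoint_left.1 (hr1 e i h h') (hF2 e h2).1 (hT3 i h1)
  have hr' : ∀ e : G.edgeSet, ∃ ε : (ℤ × ℤ) × Bool, ∃ i j, e.1 = s(i, j) ∧ i ≠ j ∧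
      ε.1 ∈ S i ∧ Grid.top ε ∈ S j := by
    intro e
    -- The last step may run against the orientation of its grid edge, in which case source and
    -- target are exchanged.
    obtain ⟨u, hu, v, hv, ε, ⟨rfl, rfl⟩ | ⟨rfl, rfl⟩⟩ := hF4 e
    · exact ⟨ε, src e, tgt e, hst e, hne e, hS.2 (Or.inr ⟨e, rfl, hu⟩), hS.2 (Or.inl hv)⟩
    · exact ⟨ε, tgt e, src e, (hst e).trans Sym2.eq_swap, (hne e).symm, hS.2 (Or.inl hv),
        hS.2 (Or.inr ⟨e, rfl, hu⟩)⟩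
  choose ρ s t hst' hne' hρ1 hρ2 using hr'
  let D : Grid.Drawing ι G.edgeSet :=
    { S := S
      base := fun i => Grid.near δ (x i)
      src := s
      tgt := t
      r := ρ
      disj := by
        intro i j v hi hj
        rcases hS.1 hi with hi' | ⟨e, rfl, hi'⟩ <;> rcases hS.1 hj with hj' | ⟨e', rfl, hj'⟩
        · exact hTd hi' (hT3 j hj')
        · exact hTF hi' hj'
        · exact (hTF hj' hi').symm
        · by_cases h : e = e'
          · rw [h]
          · exact (Set.disjoint_left.1 (hr2 e e' h) (hF2 e hi').1 (hF2 e' hj').1).elim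
      conn := by
        intro i v hv
        have hTS : (T i : Set (ℤ × ℤ)) ⊆ S i := fun v hv => hS.2 (Or.inl hv)
        rcases hS.1 hv with hv' | ⟨e, rfl, hv'⟩
        · exact Grid.reach_mono hTS (hT4 i v hv')
        · exact (Grid.reach_mono hTS (hT4 _ _ (haT e))).trans
            (Grid.reach_mono (fun v hv => hS.2 (Or.inr ⟨e, rfl, hv⟩)) (hF3 e v hv'))
      ne := hne'
      inj := fun {e e'} h1 h2 => Subtype.ext (by rw [hst', hst', h1, h2])
      inj' := fun {e e'} h1 h2 => Subtype.ext (by rw [hst', hst', h1, h2, Sym2.eq_swap])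
      r_src := hρ1
      r_tgt := hρ2 }
  have := D.card_edges_add_three_le
  rwa [← SimpleGraph.edgeFinset_card] at this

/-- The sphere without one point is a plane. -/
lemma exists_isOpenEmbedding_plane (q : Sphere2) :
    ∃ ψ : ℝ × ℝ → Sphere2, IsOpenEmbedding ψ ∧ Set.range ψ = {q}ᶜ := by
  have : Fact (Module.finrank ℝ (EuclideanSpace ℝ (Fin 3)) = 2 + 1) := ⟨by simp⟩
  let φ := (stereographic' 2 q).symm
  have h1 : IsOpenEmbedding φ := φ.isOpenEmbedding (by simp [φ])
  have h2 : Set.range φ = {q}ᶜ := by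
    rw [← Set.image_univ, ← stereographic'_target (E := EuclideanSpace ℝ (Fin 3)) q,
      ← stereographic'_source (n := 2) q]
    exact (stereographic' 2 q).symm_image_target_eq_source
  let χ : ℝ × ℝ ≃ₜ EuclideanSpace ℝ (Fin 2) :=
    (Homeomorph.finTwoArrow (X := ℝ)).symm.trans
      (EuclideanSpace.equiv (Fin 2) ℝ).symm.toHomeomorph
  exact ⟨φ ∘ χ, h1.comp χ.isOpenEmbedding, by rw [χ.surjective.range_comp, h2]⟩

/-- Projection from a point of `P` turns this into the connectedness of a plane without finitely
many points. -/
lemma isPreconnected_compl_of_finite {P : Set Sphere2} (hP : P.Finite) (hne : P.Nonempty) :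
    IsPreconnected Pᶜ := by
  obtain ⟨q, hq⟩ := hne
  obtain ⟨ψ, h1, h2⟩ := exists_isOpenEmbedding_plane q
  have h3 : IsConnected (ψ ⁻¹' P)ᶜ :=
    (hP.preimage h1.injective.injOn).countable.isConnected_compl_of_one_lt_rank (by
      rw [← Module.finrank_eq_rank]; norm_num)
  have h4 : ψ '' (ψ ⁻¹' P)ᶜ = Pᶜ := by
    rw [← Set.preimage_compl, Set.image_preimage_eq_inter_range, h2]
    refine Set.inter_eq_left.2 fun x hx hxq => hx ?_
    rwa [Set.mem_singleton_iff.1 hxq]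
  rw [← h4]
  exact h3.isPreconnected.image ψ h1.continuous.continuousOn

/-- Disjoint connected open sets on the sphere: there are at most `3 n - 3` pairs with a common
boundary point that is not on the boundary of the other sets. -/
theorem card_edgeFinset_add_three_le_of_sphere {ι : Type*} [Fintype ι] [Nonempty ι]
    (U : ι → Set Sphere2) (hU : ∀ i, IsOpen (U i)) (hc : ∀ i, IsConnected (U i))
    (hd : Pairwise fun i j => Disjoint (U i) (U j)) (G : SimpleGraph ι) [Fintype G.edgeSet]
    (hG : ∀ i j, G.Adj i j → ∃ p ∈ closure (U i), p ∈ closure (U j) ∧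
      ∀ k, k ≠ i → k ≠ j → p ∉ closure (U k)) :
    G.edgeFinset.card + 3 ≤ 3 * Fintype.card ι := by
  classical
  by_cases h0 : ∃ i j, G.Adj i j
  swap
  · have : G.edgeFinset = ∅ := by
      rw [SimpleGraph.edgeFinset_eq_empty]
      ext i j
      simpa using fun h => h0 ⟨i, j, h⟩
    rw [this, Finset.card_empty]
    have := Fintype.card_pos (α := ι)
    omega
  have : Nonempty Sphere2 := (hc (Classical.arbitrary ι)).nonempty.to_type
  choose! p hp1 hp2 hp3 using hG
  have hpU : ∀ i j, G.Adj i j → ∀ k, p i j ∉ U k := by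
    intro i j h k hk
    have hki : ∀ l, p i j ∈ closure (U l) → k = l := by
      intro l hl
      by_contra hkl
      exact Set.disjoint_left.1 ((hd hkl).closure_right (hU k)) hk hl
    exact G.ne_of_adj h ((hki i (hp1 i j h)).symm.trans (hki j (hp2 i j h)))
  let P : Set Sphere2 := (fun x : ι × ι => p x.1 x.2) '' {x | G.Adj x.1 x.2}
  have hP : P.Finite := Set.toFinite _
  obtain ⟨i₀, j₀, h0⟩ := h0
  have hPU : ∀ k, U k ⊆ Pᶜ := by
    rintro k x hx ⟨y, hy, rfl⟩
    exact hpU _ _ hy k hx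
  -- The centre of projection must avoid the countries and the contact points. Otherwise the
  -- countries would cover the connected set `Pᶜ`, with `U i₀` and the union of the others
  -- separating it.
  obtain ⟨q, hqP, hqU⟩ : ∃ q ∉ P, ∀ k, q ∉ U k := by
    by_contra! hcon
    have hV : IsOpen (⋃ k : {k // k ≠ i₀}, U k.1) := isOpen_iUnion fun k => hU k.1
    obtain ⟨x, hx⟩ := (hc i₀).nonempty
    obtain ⟨y, hy⟩ := (hc j₀).nonempty
    obtain ⟨z, -, hz1, hz2⟩ := isPreconnected_compl_of_finite hP ⟨_, (i₀, j₀), h0, rfl⟩ (U i₀) _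
      (hU i₀) hV (fun q hq => by
        obtain ⟨k, hk⟩ := hcon q hq
        by_cases hki : k = i₀
        · exact Or.inl (hki ▸ hk)
        · exact Or.inr (Set.mem_iUnion.2 ⟨⟨k, hki⟩, hk⟩)) ⟨x, hPU _ hx, hx⟩
      ⟨y, hPU _ hy, Set.mem_iUnion.2 ⟨⟨j₀, (G.ne_of_adj h0).symm⟩, hy⟩⟩
    obtain ⟨⟨k, hk⟩, hz2⟩ := Set.mem_iUnion.1 hz2
    exact Set.disjoint_left.1 (hd hk) hz2 hz1
  obtain ⟨ψ, hψ, hr⟩ := exists_isOpenEmbedding_plane q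
  have hcl : ∀ k, closure (ψ ⁻¹' U k) = ψ ⁻¹' closure (U k) := fun k =>
    (hψ.isOpenMap.preimage_closure_eq_closure_preimage hψ.continuous _).symm
  refine card_edgeFinset_add_three_le_of_plane (fun k => ψ ⁻¹' U k)
    (fun k => (hU k).preimage hψ.continuous) (fun k => ?_)
    (fun i j h => (hd h).preimage ψ) G fun i j h => ?_
  · refine (hc k).preimage_of_isOpenMap hψ.injective hψ.isOpenMap ?_
    rw [hr]
    rintro x hx rfl
    exact hqU k hx
  · obtain ⟨x, hx⟩ : p i j ∈ Set.range ψ := by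
      rw [hr]
      rintro rfl
      exact hqP ⟨(i, j), h, rfl⟩
    simp only [hcl]
    exact ⟨x, by simpa [hx] using hp1 i j h, by simpa [hx] using hp2 i j h, fun k h1 h2 => by
      simpa [hx] using hp3 i j h k h1 h2⟩

/-! ### Greedy colouring and the upper bound. -/

/-- Greedy colouring of a graph whose finite subgraphs have vertices of small degree. -/
lemma SimpleGraph.exists_coloring_of_degenerate {A : Type*} (H : SimpleGraph A) (n : ℕ) [NeZero n]
    (h : ∀ s : Finset A, s.Nonempty → ∃ a ∈ s, ∃ t : Finset A, t.card < n ∧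
      ∀ b ∈ s, H.Adj a b → b ∈ t)
    (s : Finset A) : ∃ c : A → Fin n, ∀ a ∈ s, ∀ b ∈ s, H.Adj a b → c a ≠ c b := by
  classical
  induction hk : s.card generalizing s with
  | zero =>
    obtain rfl := Finset.card_eq_zero.1 hk
    exact ⟨fun _ => 0, by simp⟩
  | succ k ih =>
    obtain ⟨a, ha, t, ht, hdeg⟩ := h s (Finset.card_pos.1 (by omega))
    obtain ⟨c, hc⟩ := ih (s.erase a) (by rw [Finset.card_erase_of_mem ha]; omega)
    obtain ⟨x, hx⟩ : ∃ x, x ∉ t.image c := by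
      by_contra! hcon
      have h1 : Finset.univ ⊆ t.image c := fun x _ => hcon x
      have h2 := (Finset.card_le_card h1).trans Finset.card_image_le
      rw [Finset.card_univ, Fintype.card_fin] at h2
      omega
    have hx' : ∀ b ∈ s, H.Adj a b → x ≠ c b := fun b hb hab h =>
      hx (h ▸ Finset.mem_image_of_mem c (hdeg b hb hab))
    refine ⟨Function.update c a x, fun u hu v hv huv => ?_⟩
    by_cases hua : u = a
    · subst hua
      rw [Function.update_self, Function.update_of_ne (H.ne_of_adj huv).symm]
      exact hx' v hv huv
    · rw [Function.update_of_ne hua]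
      by_cases hva : v = a
      · subst hva
        rw [Function.update_self]
        exact (hx' u hu huv.symm).symm
      · rw [Function.update_of_ne hva]
        exact hc u (Finset.mem_erase.2 ⟨hua, hu⟩) v (Finset.mem_erase.2 ⟨hva, hv⟩) huv

namespace SphereMap

variable {ι A : Type*}

/-- Double counting. Distinct ordered pairs of neighbouring empires in `s` come from distinct darts
of the country graph on `I`. If every empire had `6 m` neighbours in `s`, then `6 m |s| ≤ 2 (3 |I| -
3) < 6 |I| ≤ 6 m |s|`. -/
lemma exists_few_neighbours [Finite ι] (M : SphereMap ι) (h : ι → A) {m : ℕ} (hm : 0 < m)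
    (hM : IsMPire m h) (s : Finset A) (hs : s.Nonempty) : ∃ a ∈ s, ∃ t : Finset A,
      t.card < 6 * m ∧ ∀ b ∈ s, (M.empireGraph h).Adj a b → b ∈ t := by
  classical
  have := Fintype.ofFinite ι
  by_contra! hcon
  let N : A → Finset A := fun a => s.filter fun b => (M.empireGraph h).Adj a b
  have hN : ∀ a ∈ s, 6 * m ≤ (N a).card := by
    intro a ha
    by_contra! hlt
    obtain ⟨b, hb, hab, hbt⟩ := hcon a ha (N a) hlt
    exact hbt (Finset.mem_filter.2 ⟨hb, hab⟩)
  let I := {i // h i ∈ s}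
  let G : SimpleGraph I := M.countryGraph.comap Subtype.val
  have hcard : Fintype.card I ≤ m * s.card := by
    have h1 : Fintype.card I = ∑ a ∈ s, (Finset.univ.filter fun i => h i = a).card := by
      have h2 := Finset.card_eq_sum_card_fiberwise (f := h)
        (s := Finset.univ.filter fun i => h i ∈ s) (t := s) (fun i hi => (Finset.mem_filter.1 hi).2)
      rw [Fintype.card_subtype, h2]
      refine Finset.sum_congr rfl fun a ha => ?_
      congr 1
      ext i
      simp only [Finset.mem_filter, Finset.mem_univ, true_and]
      exact ⟨fun h => h.2, fun h => ⟨h ▸ ha, h⟩⟩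
    rw [h1, mul_comm, ← smul_eq_mul, ← Finset.sum_const]
    refine Finset.sum_le_sum fun a _ => ?_
    have := hM a
    rw [show h ⁻¹' {a} = ↑(Finset.univ.filter fun i => h i = a) by ext; simp,
      Set.encard_coe_eq_coe_finsetCard] at this
    exact_mod_cast this
  have hpair : ∑ a ∈ s, (N a).card ≤ Fintype.card G.Dart := by
    have h1 : ∀ x ∈ s.sigma N, ∃ d : G.Dart, h d.fst.1 = x.1 ∧ h d.snd.1 = x.2 := by
      rintro ⟨a, b⟩ hx
      obtain ⟨ha, hb⟩ := Finset.mem_sigma.1 hx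
      obtain ⟨hb, -, i, j, rfl, rfl, hij⟩ := Finset.mem_filter.1 hb
      exact ⟨⟨(⟨i, ha⟩, ⟨j, hb⟩), hij⟩, rfl, rfl⟩
    choose d hd1 hd2 using h1
    rw [← Finset.card_sigma, ← Fintype.card_coe]
    refine Fintype.card_le_of_injective (fun x => d x.1 x.2) ?_
    rintro ⟨⟨a, b⟩, hx⟩ ⟨⟨a', b'⟩, hy⟩ hxy
    simp only at hxy
    have e1 := hd1 _ hx
    have e2 := hd2 _ hx
    rw [hxy] at e1 e2
    obtain rfl := e1.symm.trans (hd1 _ hy)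
    obtain rfl := e2.symm.trans (hd2 _ hy)
    rfl
  have hsum : s.card * (6 * m) ≤ ∑ a ∈ s, (N a).card := by
    rw [← smul_eq_mul, ← Finset.sum_const]
    exact Finset.sum_le_sum hN
  rw [G.dart_card_eq_twice_card_edges] at hpair
  have hpos : 0 < s.card * (6 * m) := Nat.mul_pos hs.card_pos (by omega)
  have : Nonempty I := by
    by_contra hI
    rw [not_nonempty_iff] at hI
    have : G.edgeFinset = ∅ := by
      rw [SimpleGraph.edgeFinset_eq_empty]
      exact Subsingleton.elim _ _
    rw [this, Finset.card_empty] at hpair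
    omega
  have hplane := card_edgeFinset_add_three_le_of_sphere (fun i : I => M.country i.1)
    (fun i => M.isOpen_country i.1) (fun i => M.isConnected_country i.1)
    (fun i j hij => M.disjoint_country fun h => hij (Subtype.ext h)) G (by
      rintro i j ⟨hij, p, hp1, hp2, hp3⟩
      refine ⟨p, hp1, hp2, fun k hki hkj hk => hp3 ⟨i.1, j.1, k.1, hij, ?_, ?_, hp1, hp2, hk⟩⟩
      · exact fun h => hkj (Subtype.ext h.symm)
      · exact fun h => hki (Subtype.ext h.symm))
  have h6 : s.card * (6 * m) = 6 * (m * s.card) := by ring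
  omega

/-- Every `m`-pire map on the sphere can be coloured with `6 m` colours. -/
theorem empireGraph_colorable [Finite ι] (M : SphereMap ι) (h : ι → A) {m : ℕ} (hm : 0 < m)
    (hM : IsMPire m h) : (M.empireGraph h).Colorable (6 * m) := by
  classical
  have := Fintype.ofFinite ι
  have : NeZero (6 * m) := ⟨by omega⟩
  obtain ⟨c, hc⟩ := (M.empireGraph h).exists_coloring_of_degenerate (6 * m)
    -- `A` may be infinite, but empires without countries have no neighbours, so a colouring that is
    -- proper on the image of `h` suffices.
    (M.exists_few_neighbours h hm hM) (Finset.univ.image h)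
  refine ⟨SimpleGraph.Coloring.mk c fun {a b} hab => hc a ?_ b ?_ hab⟩
  · obtain ⟨-, i, j, rfl, rfl, -⟩ := hab
    simp
  · obtain ⟨-, i, j, rfl, rfl, -⟩ := hab
    simp

end SphereMap

/-! ### Maps on the sphere from horizontal bars. -/

/-- A family of horizontal bars in the plane. The bar `v` has height `y v` and lies over the
interval from `l v` to `e v`; the bar `b` is below all others, and as wide as all of them. -/
structure Bars (V : Type*) where
  l : V → ℤ
  e : V → ℤ
  y : V → ℤ
  b : V
  lt : ∀ v, l v < e v
  b_lt : ∀ v, v ≠ b → y b < y v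
  l_b : ∀ v, l b ≤ l v
  e_b : ∀ v, e v ≤ e b
  sep : ∀ v w, v ≠ w → y v = y w → e v ≤ l w ∨ e w ≤ l v

namespace Bars

variable {V : Type*} (B : Bars V)

/-- The part of the plane above the bar `v` and below the next bars. -/
def region (v : V) : Set (ℝ × ℝ) :=
  {p | (v = B.b ∨ (B.l v < p.1 ∧ p.1 < B.e v ∧ B.y v < p.2)) ∧
    ∀ w, B.y v < B.y w → B.l w ≤ p.1 → p.1 ≤ B.e w → p.2 < B.y w}

/-- The bar `v` is the next one above the bar `u` in the column from `t` to `t + 1`. -/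
def Touch (u v : V) : Prop :=
  ∃ t, B.l u ≤ t ∧ t < B.e u ∧ B.l v ≤ t ∧ t < B.e v ∧ B.y u < B.y v ∧
    ∀ w, B.l w ≤ t → t < B.e w → B.y w ≤ B.y u ∨ B.y v ≤ B.y w

lemma isOpen_region [Finite V] (v : V) : IsOpen (B.region v) := by
  have h1 : IsOpen {p : ℝ × ℝ | v = B.b ∨ (B.l v < p.1 ∧ p.1 < B.e v ∧ B.y v < p.2)} := by
    refine isOpen_const.union ((isOpen_lt continuous_const continuous_fst).inter
      ((isOpen_lt continuous_fst continuous_const).inter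
        (isOpen_lt continuous_const continuous_snd)))
  have h2 : IsOpen (⋂ w, {p : ℝ × ℝ | B.y v < B.y w → B.l w ≤ p.1 → p.1 ≤ B.e w →
      p.2 < B.y w}) := by
    refine isOpen_iInter_of_finite fun w => ?_
    by_cases h : B.y v < B.y w
    · have : IsClosed {p : ℝ × ℝ | B.l w ≤ p.1 ∧ p.1 ≤ B.e w ∧ B.y w ≤ p.2} :=
        (isClosed_le continuous_const continuous_fst).inter
          ((isClosed_le continuous_fst continuous_const).inter
            (isClosed_le continuous_const continuous_snd))
      convert this.isOpen_compl using 1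
      ext p
      simp [h]
    · simp [h]
  convert h1.inter h2 using 1
  ext p
  simp [region]

lemma add_half_lt {v w : V} (h : B.y v < B.y w) : (B.y v : ℝ) + 1 / 2 < B.y w := by
  have : (B.y v : ℝ) + 1 ≤ B.y w := by exact_mod_cast h
  linarith

/-- Heights are integers, so no bar obstructs the horizontal line at height `B.y v + 1 / 2`. Every
point of the region is joined to that line by a vertical segment. -/
lemma isConnected_region (v : V) : IsConnected (B.region v) := by
  let I : Set ℝ := {x | v = B.b ∨ (B.l v < x ∧ x < B.e v)}
  let C : Set (ℝ × ℝ) := I ×ˢ {(B.y v : ℝ) + 1 / 2}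
  have hI : IsPreconnected I := by
    by_cases h : v = B.b
    · simpa [I, h] using isPreconnected_univ
    · simp only [I, h, false_or]
      exact isPreconnected_Ioo
  have hC : IsPreconnected C := hI.prod isPreconnected_singleton
  have hCR : C ⊆ B.region v := by
    rintro ⟨x, s⟩ ⟨hx, rfl⟩
    refine ⟨?_, fun w hw _ _ => B.add_half_lt hw⟩
    rcases hx with hx | ⟨h1, h2⟩
    · exact Or.inl hx
    · exact Or.inr ⟨h1, h2, by simp⟩
  obtain ⟨x₀, hx₀⟩ : I.Nonempty := by
    have : (B.l v : ℝ) + 1 ≤ B.e v := by exact_mod_cast B.lt v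
    exact ⟨B.l v + 1 / 2, Or.inr ⟨by linarith, by linarith⟩⟩
  have hx₀C : (x₀, (B.y v : ℝ) + 1 / 2) ∈ C := ⟨hx₀, rfl⟩
  refine ⟨⟨_, hCR hx₀C⟩, isPreconnected_of_forall (x₀, (B.y v : ℝ) + 1 / 2) ?_⟩
  rintro ⟨x, s⟩ ⟨h1, h2⟩
  have hx : x ∈ I := by
    rcases h1 with h1 | ⟨h1, h1', -⟩
    exacts [Or.inl h1, Or.inr ⟨h1, h1'⟩]
  refine ⟨({x} ×ˢ Set.uIcc s ((B.y v : ℝ) + 1 / 2)) ∪ C, ?_, Or.inr hx₀C,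
    Or.inl ⟨rfl, Set.left_mem_uIcc⟩, ?_⟩
  · refine Set.union_subset ?_ hCR
    rintro ⟨x', s'⟩ ⟨rfl, hs⟩
    have hs' := Set.mem_uIcc.1 hs
    refine ⟨?_, fun w hw hl he => ?_⟩
    · rcases h1 with h1 | ⟨h1, h1', h1''⟩
      · exact Or.inl h1
      · refine Or.inr ⟨h1, h1', ?_⟩
        simp only at h1'' ⊢
        rcases hs' with h | h <;> linarith [h.1]
    · have := h2 w hw hl he
      have := B.add_half_lt hw
      simp only at *
      rcases hs' with h | h <;> linarith [h.2]
  · exact (isPreconnected_singleton.prod isPreconnected_uIcc).union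
      (x, (B.y v : ℝ) + 1 / 2) ⟨rfl, Set.right_mem_uIcc⟩ ⟨hx, rfl⟩ hC

lemma disjoint_region {u v : V} (h : u ≠ v) : Disjoint (B.region u) (B.region v) := by
  have key : ∀ {u v : V}, v ≠ B.b → B.y u < B.y v → Disjoint (B.region u) (B.region v) := by
    intro u v hv huv
    refine Set.disjoint_left.2 fun p hu hvp => ?_
    obtain ⟨h1, h2, h3⟩ := hvp.1.resolve_left hv
    exact lt_asymm h3 (hu.2 v huv h1.le h2.le)
  by_cases hu : u = B.b
  · subst hu
    exact key h.symm (B.b_lt v h.symm)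
  by_cases hv : v = B.b
  · subst hv
    exact (key h (B.b_lt u h)).symm
  rcases lt_trichotomy (B.y u) (B.y v) with huv | huv | huv
  · exact key hv huv
  · refine Set.disjoint_left.2 fun p hup hvp => ?_
    obtain ⟨h1, h2, -⟩ := hup.1.resolve_left hu
    obtain ⟨h3, h4, -⟩ := hvp.1.resolve_left hv
    rcases B.sep u v h huv with h5 | h5
    · have : (B.e u : ℝ) ≤ B.l v := by exact_mod_cast h5
      linarith
    · have : (B.e v : ℝ) ≤ B.l u := by exact_mod_cast h5
      linarith
  · exact (key hu huv).symm

/-- A point with no integer coordinate lies in the region of the highest bar below it, or of `B.b`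
if there is none. -/
lemma dense_iUnion_region [Finite V] : Dense (⋃ v, B.region v) := by
  have h1 : Dense (Set.range ((↑) : ℤ → ℝ))ᶜ := (Set.countable_range _).dense_compl ℝ
  refine (h1.prod h1).mono ?_
  rintro ⟨x, s⟩ ⟨hx, hs⟩
  have hx' : ∀ n : ℤ, (n : ℝ) ≠ x := fun n h => hx ⟨n, h⟩
  have hs' : ∀ n : ℤ, (n : ℝ) ≠ s := fun n h => hs ⟨n, h⟩
  let T : Set V := {v | B.l v < x ∧ x < B.e v ∧ B.y v < s}
  rw [Set.mem_iUnion]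
  by_cases hT : T.Nonempty
  · obtain ⟨v, hv, hmax⟩ := (Set.toFinite T).exists_maximalFor B.y T hT
    refine ⟨v, Or.inr hv, fun w hw h1 h2 => ?_⟩
    by_contra! h3
    have hwT : w ∈ T := ⟨h1.lt_of_ne (hx' _), h2.lt_of_ne (hx' _).symm, h3.lt_of_ne (hs' _)⟩
    exact absurd (hmax hwT hw.le) (not_le.2 hw)
  · refine ⟨B.b, Or.inl rfl, fun w hw h1 h2 => ?_⟩
    by_contra! h3
    exact hT ⟨w, h1.lt_of_ne (hx' _), h2.lt_of_ne (hx' _).symm, h3.lt_of_ne (hs' _)⟩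

/-- The common point lies on the upper bar `v` in the middle of the column: the region of `u`
reaches it from below and that of `v` from above. The surrounding box of width one and height two
meets no third region, because any other bar in the column is cut off by `u` or starts above the
box. -/
lemma Touch.exists_mem_closure {B : Bars V} {u v : V} (h : B.Touch u v) :
    ∃ p ∈ closure (B.region u), p ∈ closure (B.region v) ∧
      ∀ k, k ≠ u → k ≠ v → p ∉ closure (B.region k) := by
  obtain ⟨t, hu1, hu2, hv1, hv2, huv, ht⟩ := h
  have hact : ∀ {w} {x : ℝ}, (t : ℝ) < x → x < t + 1 → (B.l w : ℝ) ≤ x → x ≤ B.e w →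
      B.l w ≤ t ∧ t < B.e w := by
    intro w x h1 h2 h3 h4
    have h5 : (B.l w : ℝ) < (t + 1 : ℤ) := by push_cast; linarith
    have h6 : (t : ℝ) < B.e w := by linarith
    exact ⟨by have := Int.cast_lt.1 h5; omega, Int.cast_lt.1 h6⟩
  have hact' : ∀ {w}, B.l w ≤ t → t < B.e w → ∀ x : ℝ, (t : ℝ) < x → x < t + 1 →
      (B.l w : ℝ) < x ∧ x < B.e w := by
    intro w h1 h2 x h3 h4
    have h5 : (B.l w : ℝ) ≤ t := by exact_mod_cast h1
    have h6 : (t : ℝ) + 1 ≤ B.e w := by exact_mod_cast h2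
    exact ⟨by linarith, by linarith⟩
  have huv' : (B.y u : ℝ) + 1 ≤ B.y v := by exact_mod_cast huv
  have hvb : v ≠ B.b := by
    rintro rfl
    by_cases hub : u = B.b
    · exact lt_irrefl _ (hub ▸ huv)
    · exact lt_asymm huv (B.b_lt u hub)
  set x : ℝ := t + 1 / 2 with hx
  have hx1 : (t : ℝ) < x := by linarith
  have hx2 : x < t + 1 := by linarith
  refine ⟨(x, B.y v), ?_, ?_, fun k hku hkv hk => ?_⟩
  · have h1 : Filter.Tendsto (fun η : ℝ => (x, (B.y v : ℝ) - η)) (𝓝[>] 0) (𝓝 (x, B.y v)) := by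
      have : Continuous fun η : ℝ => (x, (B.y v : ℝ) - η) := by fun_prop
      simpa using (this.tendsto 0).mono_left nhdsWithin_le_nhds
    refine mem_closure_of_tendsto h1 ?_
    filter_upwards [Ioo_mem_nhdsGT one_pos] with η hη
    refine ⟨Or.inr ⟨(hact' hu1 hu2 x hx1 hx2).1, (hact' hu1 hu2 x hx1 hx2).2, ?_⟩,
      fun w hw hl he => ?_⟩
    · have := hη.2
      simp only
      linarith
    · have h2 := hact hx1 hx2 hl he
      have h3 : (B.y v : ℝ) ≤ B.y w := by
        exact_mod_cast (ht w h2.1 h2.2).resolve_left (not_le.2 hw)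
      have := hη.1
      simp only
      linarith
  · have h1 : Filter.Tendsto (fun η : ℝ => (x, (B.y v : ℝ) + η)) (𝓝[>] 0) (𝓝 (x, B.y v)) := by
      have : Continuous fun η : ℝ => (x, (B.y v : ℝ) + η) := by fun_prop
      simpa using (this.tendsto 0).mono_left nhdsWithin_le_nhds
    refine mem_closure_of_tendsto h1 ?_
    filter_upwards [Ioo_mem_nhdsGT one_pos] with η hη
    refine ⟨Or.inr ⟨(hact' hv1 hv2 x hx1 hx2).1, (hact' hv1 hv2 x hx1 hx2).2, ?_⟩,
      fun w hw hl he => ?_⟩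
    · have := hη.1
      simp only
      linarith
    · have h3 : (B.y v : ℝ) + 1 ≤ B.y w := by exact_mod_cast hw
      have := hη.2
      simp only
      linarith
  · have hO : IsOpen (Set.Ioo (t : ℝ) (t + 1) ×ˢ Set.Ioo ((B.y v : ℝ) - 1) (B.y v + 1)) :=
      isOpen_Ioo.prod isOpen_Ioo
    obtain ⟨⟨x', s'⟩, ⟨⟨h1, h2⟩, h3, h4⟩, hk1, hk2⟩ := mem_closure_iff.1 hk _ hO
      ⟨⟨hx1, hx2⟩, by simp, by simp⟩
    simp only at h1 h2 h3 h4 hk1 hk2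
    have hv' := hact' hv1 hv2 x' h1 h2
    have hu' := hact' hu1 hu2 x' h1 h2
    have hnu : ¬ B.y k < B.y u := fun h => by
      have := hk2 u h hu'.1.le hu'.2.le
      linarith
    have hkb : k ≠ B.b := by
      rintro rfl
      exact hnu (B.b_lt u hku.symm)
    obtain ⟨hk3, hk4, hk5⟩ := hk1.resolve_left hkb
    have hkt := hact h1 h2 hk3.le hk4.le
    have hneq : ∀ w, k ≠ w → B.l w ≤ t → t < B.e w → B.y k ≠ B.y w := by
      intro w hkw hw1 hw2 h
      have := B.sep k w hkw h
      omega
    have h5 := hneq u hku hu1 hu2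
    have h6 := hneq v hkv hv1 hv2
    have h7 : B.y v + 1 ≤ B.y k := by
      have := ht k hkt.1 hkt.2
      omega
    have h8 : (B.y v : ℝ) + 1 ≤ B.y k := by exact_mod_cast h7
    linarith

lemma _root_.dense_compl_singleton_sphere (q : Sphere2) : Dense ({q}ᶜ : Set Sphere2) := by
  have hr : 1 < Module.rank ℝ (EuclideanSpace ℝ (Fin 3)) := by
    rw [← Module.finrank_eq_rank]; simp
  have : ConnectedSpace Sphere2 :=
    Subtype.connectedSpace (isConnected_sphere hr 0 zero_le_one)
  have : Nontrivial Sphere2 := ⟨q, -q, fun h => by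
    have h1 : (q : EuclideanSpace ℝ (Fin 3)) = -q := congrArg Subtype.val h
    have h2 : (q : EuclideanSpace ℝ (Fin 3)) = 0 := by
      have h3 := add_eq_zero_iff_eq_neg.2 h1
      rw [← two_smul ℝ] at h3
      exact (smul_eq_zero.1 h3).resolve_left two_ne_zero
    have h3 := norm_eq_of_mem_sphere q
    rw [h2, norm_zero] at h3
    exact zero_ne_one h3⟩
  exact dense_compl_singleton q

/-- A family of bars gives a map on the sphere in which touching bars are neighbours. -/
theorem exists_sphereMap [Finite V] : ∃ M : SphereMap V, ∀ u v, B.Touch u v →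
    M.countryGraph.Adj u v := by
  let q : Sphere2 := ⟨EuclideanSpace.single 0 1, by simp⟩
  obtain ⟨ψ, hψ, hr⟩ := exists_isOpenEmbedding_plane q
  have hcl : ∀ p k, ψ p ∈ closure (ψ '' B.region k) ↔ p ∈ closure (B.region k) := by
    intro p k
    rw [← Set.mem_preimage, hψ.isOpenMap.preimage_closure_eq_closure_preimage hψ.continuous,
      Set.preimage_image_eq _ hψ.injective]
  refine ⟨{
    country := fun v => ψ '' B.region v
    isOpen_country := fun v => hψ.isOpenMap _ (B.isOpen_region v)
    isConnected_country := fun v =>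
      (B.isConnected_region v).image ψ hψ.continuous.continuousOn
    disjoint_country := fun u v h =>
      (Set.disjoint_image_iff hψ.injective).2 (B.disjoint_region h)
    dense_iUnion := by
      rw [← Set.image_iUnion]
      refine DenseRange.dense_image ?_ hψ.continuous B.dense_iUnion_region
      rw [DenseRange, hr]
      exact dense_compl_singleton_sphere q }, fun u v h => ?_⟩
  obtain ⟨p, hp1, hp2, hp3⟩ := h.exists_mem_closure
  refine ⟨?_, ψ p, (hcl _ _).2 hp1, (hcl _ _).2 hp2, ?_⟩
  · rintro rfl
    obtain ⟨t, -, -, -, -, h, -⟩ := h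
    exact lt_irrefl _ h
  · rintro ⟨i, j, k, hij, hjk, hik, hi, hj, hk⟩
    have h1 : ∀ w, ψ p ∈ closure (ψ '' B.region w) → w = u ∨ w = v := by
      intro w hw
      by_contra! hcon
      exact hp3 w hcon.1 hcon.2 ((hcl _ _).1 hw)
    have := h1 i hi
    have := h1 j hj
    have := h1 k hk
    grind

/-- Labelled bars in which any two labels touch give a map that needs all the colours. -/
theorem exists_empireMap [Finite V] {N m : ℕ} (h : V → Fin N) (hm : IsMPire m h)
    (ht : ∀ a b, a ≠ b → ∃ u v, h u = a ∧ h v = b ∧ (B.Touch u v ∨ B.Touch v u)) :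
    ∃ (n : ℕ) (M : SphereMap (Fin n)) (h : Fin n → Fin N), IsMPire m h ∧
      (∀ a b, a ≠ b → (M.empireGraph h).Adj a b) ∧
      (M.empireGraph h).chromaticNumber = (N : ℕ∞) := by
  obtain ⟨M, hM⟩ := B.exists_sphereMap
  obtain ⟨n, ⟨φ⟩⟩ := Finite.exists_equiv_fin V
  let M' : SphereMap (Fin n) :=
    { country := fun i => M.country (φ.symm i)
      isOpen_country := fun i => M.isOpen_country _
      isConnected_country := fun i => M.isConnected_country _
      disjoint_country := fun i j hij => M.disjoint_country (φ.symm.injective.ne hij)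
      dense_iUnion := by
        rw [φ.symm.surjective.iUnion_comp]
        exact M.dense_iUnion }
  have hadj : ∀ u v, M.countryGraph.Adj u v → M'.countryGraph.Adj (φ u) (φ v) := by
    rintro u v ⟨huv, p, hu, hv, hp⟩
    refine ⟨φ.injective.ne huv, p, by simpa [M'] using hu, by simpa [M'] using hv, ?_⟩
    rintro ⟨i, j, k, hij, hjk, hik, hi, hj, hk⟩
    exact hp ⟨_, _, _, φ.symm.injective.ne hij, φ.symm.injective.ne hjk,
      φ.symm.injective.ne hik, hi, hj, hk⟩
  have hall : ∀ a b, a ≠ b → (M'.empireGraph (h ∘ φ.symm)).Adj a b := by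
    intro a b hab
    obtain ⟨u, v, rfl, rfl, huv⟩ := ht a b hab
    refine ⟨hab, φ u, φ v, by simp, by simp, hadj u v ?_⟩
    rcases huv with huv | huv
    exacts [hM _ _ huv, (hM _ _ huv).symm]
  refine ⟨n, M', h ∘ φ.symm, fun a => ?_, hall, ?_⟩
  · rw [Set.preimage_comp, ← Equiv.image_eq_preimage_symm, φ.injective.encard_image]
    exact hm a
  · have : M'.empireGraph (h ∘ φ.symm) = ⊤ := by
      ext a b
      exact ⟨fun hab => hab.ne, fun hab => hall a b hab⟩
    rw [this, SimpleGraph.chromaticNumber_top, Fintype.card_fin]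

end Bars

/-! ### Tables for `m = 2` and `m = 3`. -/

namespace Bars

/-- Bars given by tables. The bar `v` has height `v`, and `W` lists witnesses that any two labels
touch: two bars and a column in which they are consecutive. -/
theorem exists_empireMap_of_table {k N m : ℕ} (l e : Fin (k + 1) → ℕ) (h : Fin (k + 1) → Fin N)
    (W : List (Fin (k + 1) × Fin (k + 1) × ℕ))
    (hle : ∀ v, l 0 ≤ l v ∧ l v < e v ∧ e v ≤ e 0)
    (hm : ∀ a, (Finset.univ.filter fun v => h v = a).card ≤ m)
    (hW : ∀ w ∈ W, w.1 < w.2.1 ∧ l w.1 ≤ w.2.2 ∧ w.2.2 < e w.1 ∧ l w.2.1 ≤ w.2.2 ∧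
      w.2.2 < e w.2.1 ∧ ∀ x, x ≤ w.1 ∨ w.2.1 ≤ x ∨ w.2.2 < l x ∨ e x ≤ w.2.2)
    (hN : ∀ a b, a < b → ∃ w ∈ W, (h w.1 = a ∧ h w.2.1 = b) ∨ (h w.1 = b ∧ h w.2.1 = a)) :
    ∃ (n : ℕ) (M : SphereMap (Fin n)) (h : Fin n → Fin N), IsMPire m h ∧
      (∀ a b, a ≠ b → (M.empireGraph h).Adj a b) ∧
      (M.empireGraph h).chromaticNumber = (N : ℕ∞) := by
  let B : Bars (Fin (k + 1)) :=
    { l := fun v => l v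
      e := fun v => e v
      y := fun v => v.1
      b := 0
      lt := fun v => by exact_mod_cast (hle v).2.1
      b_lt := fun v hv => by exact_mod_cast Fin.pos_iff_ne_zero.2 hv
      l_b := fun v => by exact_mod_cast (hle v).1
      e_b := fun v => by exact_mod_cast (hle v).2.2
      sep := fun v w hvw h => absurd (Fin.ext (by exact_mod_cast h)) hvw }
  have touch : ∀ w ∈ W, B.Touch w.1 w.2.1 := by
    intro w hw
    obtain ⟨h1, h2, h3, h4, h5, h6⟩ := hW w hw
    refine ⟨w.2.2, Int.ofNat_le.2 h2, Int.ofNat_lt.2 h3, Int.ofNat_le.2 h4, Int.ofNat_lt.2 h5,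
      Int.ofNat_lt.2 h1, fun x hx1 hx2 => ?_⟩
    rcases h6 x with h | h | h | h
    · exact Or.inl (Int.ofNat_le.2 h)
    · exact Or.inr (Int.ofNat_le.2 h)
    · exact absurd (Int.ofNat_le.1 hx1) (not_le.2 h)
    · exact absurd (Int.ofNat_lt.1 hx2) (not_lt.2 h)
  refine B.exists_empireMap h (fun a => ?_) fun a b hab => ?_
  · rw [show h ⁻¹' {a} = ↑(Finset.univ.filter fun v => h v = a) by ext; simp,
      Set.encard_coe_eq_coe_finsetCard]
    exact_mod_cast hm a
  · rcases lt_or_gt_of_ne hab with hab | hab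
    · obtain ⟨w, hw, ⟨h1, h2⟩ | ⟨h1, h2⟩⟩ := hN a b hab
      exacts [⟨_, _, h1, h2, Or.inl (touch w hw)⟩, ⟨_, _, h2, h1, Or.inr (touch w hw)⟩]
    · obtain ⟨w, hw, ⟨h1, h2⟩ | ⟨h1, h2⟩⟩ := hN b a hab
      exacts [⟨_, _, h2, h1, Or.inr (touch w hw)⟩, ⟨_, _, h1, h2, Or.inl (touch w hw)⟩]

/-- The vectors list the left ends, right ends and empires of 24 bars. Tables are needed for `m = 2,
3` because the general construction gives one empire four bars. -/
theorem exists_empireMap_two : ∃ (n : ℕ) (M : SphereMap (Fin n)) (h : Fin n → Fin 12),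
    IsMPire 2 h ∧ (∀ a b, a ≠ b → (M.empireGraph h).Adj a b) ∧
      (M.empireGraph h).chromaticNumber = ((12 : ℕ) : ℕ∞) :=
  exists_empireMap_of_table (k := 23)
      ![0, 4, 8, 7, 8, 9, 6, 7, 5, 3, 4, 5, 8, 9, 6, 2, 3, 8, 1, 2, 4, 5, 3, 0]
      ![16, 9, 12, 11, 10, 13, 10, 16, 12, 10, 9, 7, 11, 13, 10, 11, 14, 15, 4, 7, 6, 9, 10, 16]
      ![0, 7, 8, 6, 4, 9, 5, 10, 3, 11, 1, 10, 9, 2, 7, 4, 8, 11, 3, 1, 0, 5, 2, 6]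
      [(1, 9, 4), (1, 2, 8), (1, 3, 7), (1, 6, 6), (1, 8, 5), (4, 5, 9), (4, 6, 8), (18, 23, 1),
      (18, 19, 2), (19, 20, 4), (19, 22, 3), (19, 23, 2), (19, 21, 6), (13, 14, 9), (13, 16,
      11), (13, 15, 10), (7, 23, 15), (7, 17, 14), (7, 16, 13), (7, 13, 12), (7, 8, 7), (21, 22,
      5), (6, 7, 7), (6, 8, 6), (0, 1, 4), (0, 9, 3), (0, 15, 2), (0, 18, 1), (0, 23, 0), (0, 7,
      13), (0, 5, 12), (0, 2, 9), (17, 21, 8), (17, 23, 10), (17, 22, 9), (16, 17, 8), (16, 21,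
      7), (16, 19, 4), (16, 18, 3), (5, 7, 10), (5, 6, 9), (9, 12, 9), (9, 10, 4), (9, 15, 3),
      (10, 14, 7), (10, 11, 5), (10, 15, 4), (10, 12, 8), (15, 18, 2), (15, 16, 3), (8, 13, 11),
      (8, 12, 10), (8, 9, 5), (11, 15, 5), (11, 14, 6), (20, 21, 5), (20, 22, 4), (3, 5, 10),
      (3, 4, 8), (3, 6, 7), (2, 3, 8), (2, 5, 11), (14, 15, 6), (22, 23, 3), (12, 13, 9), (12,
      14, 8)]
    (by decide +kernel) (by decide +kernel) (by decide +kernel) (by decide +kernel)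

theorem exists_empireMap_three : ∃ (n : ℕ) (M : SphereMap (Fin n)) (h : Fin n → Fin 18),
    IsMPire 3 h ∧ (∀ a b, a ≠ b → (M.empireGraph h).Adj a b) ∧
      (M.empireGraph h).chromaticNumber = ((18 : ℕ) : ℕ∞) :=
  exists_empireMap_of_table (k := 53)
      ![0, 3, 8, 2, 1, 5, 4, 8, 10, 16, 17, 19, 20, 9, 11, 10, 24, 21, 23, 22, 18, 26, 3, 4, 7,
      6, 11, 10, 18, 19, 9, 5, 6, 8, 10, 9, 10, 11, 12, 7, 9, 13, 12, 14, 20, 13, 17, 14, 8, 10,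
      2, 3, 4, 0]
      ![31, 31, 29, 7, 6, 27, 6, 20, 19, 18, 25, 23, 22, 12, 14, 12, 26, 25, 28, 30, 24, 28, 7,
      13, 15, 8, 21, 17, 20, 22, 11, 7, 14, 13, 12, 11, 15, 16, 20, 23, 25, 16, 15, 27, 29, 18,
      19, 16, 11, 15, 9, 21, 22, 31]
      ![16, 4, 7, 12, 8, 17, 11, 0, 8, 14, 6, 9, 17, 4, 5, 13, 10, 5, 15, 2, 16, 6, 2, 14, 3,
      15, 7, 9, 0, 13, 2, 16, 0, 5, 1, 7, 12, 14, 10, 11, 3, 17, 1, 13, 12, 9, 8, 11, 6, 4, 1,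
      15, 3, 10]
      [(6, 22, 4), (34, 36, 11), (34, 35, 10), (20, 40, 23), (20, 39, 22), (20, 29, 21), (20,
      26, 18), (22, 50, 3), (22, 23, 4), (42, 43, 14), (42, 45, 13), (42, 49, 12), (49, 51, 10),
      (32, 50, 6), (32, 36, 13), (32, 33, 8), (32, 39, 7), (7, 13, 9), (7, 23, 8), (7, 10, 19),
      (7, 8, 10), (0, 3, 2), (0, 4, 1), (0, 53, 0), (0, 1, 3), (1, 2, 8), (1, 5, 7), (1, 3, 3),
      (1, 53, 30), (1, 19, 29), (29, 38, 19), (29, 39, 20), (48, 51, 9), (48, 50, 8), (48, 49,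
      10), (19, 53, 29), (19, 44, 28), (19, 21, 26), (19, 43, 25), (19, 40, 24), (19, 20, 22),
      (13, 15, 10), (13, 23, 9), (13, 14, 11), (35, 39, 9), (35, 36, 10), (50, 51, 3), (50, 53,
      2), (31, 32, 6), (31, 50, 5), (52, 53, 4), (5, 18, 26), (5, 16, 25), (5, 10, 20), (5, 7,
      8), (5, 23, 7), (5, 22, 6), (5, 6, 5), (10, 17, 23), (10, 11, 19), (10, 20, 18), (10, 26,
      17), (10, 16, 24), (24, 32, 8), (24, 25, 7), (24, 26, 11), (24, 27, 10), (47, 49, 14),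
      (47, 51, 15), (28, 38, 18), (28, 29, 19), (51, 53, 3), (15, 23, 10), (12, 20, 20), (12,
      17, 21), (30, 32, 9), (41, 43, 15), (41, 42, 13), (25, 32, 7), (25, 31, 6), (33, 34, 10),
      (33, 35, 9), (33, 39, 8), (33, 36, 12), (14, 24, 13), (14, 23, 12), (14, 15, 11), (16, 17,
      24), (18, 19, 23), (36, 39, 10), (36, 37, 11), (21, 44, 27), (21, 43, 26), (38, 39, 12),
      (17, 18, 23), (17, 19, 22), (17, 20, 21), (43, 44, 20), (43, 51, 19), (43, 46, 18), (43,
      45, 14), (23, 24, 7), (23, 25, 6), (23, 31, 5), (23, 50, 4), (4, 53, 1), (4, 5, 5), (4, 6,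
      4), (4, 22, 3), (4, 50, 2), (39, 40, 9), (39, 48, 8), (39, 50, 7), (40, 43, 16), (40, 41,
      13), (40, 42, 12), (40, 49, 11), (40, 48, 9), (9, 10, 17), (9, 26, 16), (45, 49, 13), (45,
      46, 17), (45, 51, 16), (45, 47, 14), (46, 51, 17), (8, 10, 18), (8, 9, 16), (8, 26, 15),
      (8, 24, 14), (8, 14, 12), (8, 13, 10), (37, 38, 12), (37, 39, 11), (11, 20, 19), (11, 17,
      22), (11, 12, 20), (2, 19, 28), (2, 18, 27), (2, 5, 8), (44, 52, 21), (44, 51, 20), (44,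
      53, 22), (3, 4, 2), (3, 5, 6), (26, 29, 20), (26, 28, 18), (26, 38, 17), (26, 27, 11),
      (27, 37, 15), (27, 36, 14), (27, 32, 11), (27, 30, 10), (27, 38, 16)]
    (by decide +kernel) (by decide +kernel) (by decide +kernel) (by decide +kernel)

end Bars

/-! ### The bars for large empires -/

/-- Names of bars. -/
inductive Bar : Type
  | hub (j : ℕ)
  | path (j i : ℕ)
  | extra (k : ℕ)

namespace Bar

variable (n : ℕ)

/-- The names that are in use. -/
def Valid : Bar → Prop
  | hub j => j ≤ 6 * n + 5
  -- The label of `path 3 1` would be `3 (n + 1) + 3 n + 2 = 0`. The background `hub (6 n + 5)` also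
  -- has label `0` and takes its place in that empire.
  | path j i => j < 6 * n + 5 ∧ 1 ≤ i ∧ i ≤ n ∧ ¬ (j = 3 ∧ i = 1)
  | extra k => k < 4

/-- The first column of a bar. The columns are divided into blocks of length `2 n + 3`, and a column
is given by its block and its place in the block. -/
def start : Bar → ℤ × ℤ
  -- In a general block `J` the hubs `J` and `J + 1` run on either side of the path bars, and the
  -- hub `J + 2` enters for the last two columns. The exceptional bars close the construction into a
  -- cycle.
  | hub j => if j = 6 * n + 5 then (-2, 0) else if j = 0 then (0, 0) else
      if j = 6 * n + 4 then (-1, 2 * n + 1) else if j = 1 then (-1, 2 * n) else (j - 2, 2 * n + 1)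
  | path j i => if j = 6 * n + 4 ∧ i = 1 then (-1, 2 * n) else (j, 2 * (n - i) + 1)
  | extra k => if k = 0 then (-1, 2 * n + 2) else if k = 1 then (11, 1) else
      if k = 2 then (5, 1) else (2, 0)

/-- The last column of a bar. -/
def finish : Bar → ℤ × ℤ
  | hub j => if j = 6 * n + 5 then (6 * n + 6, 0) else if j = 0 then (3, 0) else
      if j = 6 * n + 4 ∨ j < 6 * n + 2 then (j, 2 * n + 2) else (j, 2 * n)
  | path j i => if j = 6 * n + 4 ∧ i = 1 then (6 * n + 5, 3) else
      if j = 6 * n + 4 ∧ i = 2 then (6 * n + 5, 1) else (j, 2 * (n - i) + 3)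
  | extra k => if k = 0 then (6 * n + 2, 1) else if k = 1 then (6 * n + 3, 1) else
      if k = 2 then (10, 2 * n + 2) else (2, 0)

/-- The height of a bar. -/
def height : Bar → ℤ
  -- General odd hubs lie low and rise with `j`; general even hubs lie high and descend. Thus
  -- neighbouring hubs face each other across the path bars, and a later hub is nearer to the middle
  -- than an earlier one of the same parity.
  | hub j => if j = 6 * n + 5 then 0 else if j = 0 then 60 * n + 51 else
      if j = 6 * n + 4 then 60 * n + 53 else if j % 2 = 1 then 3 + j else 60 * n + 50 - j
  | path j i => if j = 6 * n + 4 ∧ i = 1 then 60 * n + 54 else 24 * n + 20 + (n - i)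
  | extra k => if k = 0 then 60 * n + 52 else if k = 1 then 1 else if k = 2 then 2 else
      24 * n + 19

/-- The bar is present in the column `τ` of the block `J`. -/
def Active (v : Bar) (J τ : ℤ) : Prop :=
  ((start n v).1 < J ∨ (start n v).1 = J ∧ (start n v).2 ≤ τ) ∧
    (J < (finish n v).1 ∨ J = (finish n v).1 ∧ τ ≤ (finish n v).2)

variable {n}

lemma valid_hub {j : ℕ} : Valid n (hub j) ↔ j ≤ 6 * n + 5 := Iff.rfl

lemma valid_path {j i : ℕ} : Valid n (path j i) ↔
    j < 6 * n + 5 ∧ 1 ≤ i ∧ i ≤ n ∧ ¬ (j = 3 ∧ i = 1) := Iff.rfl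

lemma valid_extra {k : ℕ} : Valid n (extra k) ↔ k < 4 := Iff.rfl

lemma finite_valid : Finite {v // Valid n v} := by
  have h : Set.Finite (hub '' Set.Iic (6 * n + 5) ∪
      Set.image2 path (Set.Iio (6 * n + 5)) (Set.Iic n) ∪ extra '' Set.Iio 4) :=
    (((Set.finite_Iic _).image _).union ((Set.finite_Iio _).image2 _ (Set.finite_Iic _))).union
      ((Set.finite_Iio _).image _)
  refine (h.subset fun v hv => ?_).to_subtype
  match v, hv with
  | hub j, hv => exact Or.inl (Or.inl ⟨j, hv, rfl⟩)
  | path j i, hv => exact Or.inl (Or.inr ⟨j, hv.1, i, hv.2.2.1, rfl⟩)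
  | extra k, hv => exact Or.inr ⟨k, hv, rfl⟩

lemma column_le_iff {a b σ τ : ℤ} (hσ : 0 ≤ σ) (hσ' : σ < 2 * n + 3) (hτ : 0 ≤ τ)
    (hτ' : τ < 2 * n + 3) :
    a * (2 * n + 3) + σ ≤ b * (2 * n + 3) + τ ↔ a < b ∨ a = b ∧ σ ≤ τ := by
  constructor
  · intro h
    rcases lt_trichotomy a b with hab | rfl | hab
    · exact Or.inl hab
    · exact Or.inr ⟨rfl, by linarith⟩
    · have h1 : (b + 1) * (2 * n + 3 : ℤ) ≤ a * (2 * n + 3) :=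
        mul_le_mul_of_nonneg_right hab (by positivity)
      linarith
  · rintro (hab | ⟨rfl, h⟩)
    · have h1 : (a + 1) * (2 * n + 3 : ℤ) ≤ b * (2 * n + 3) :=
        mul_le_mul_of_nonneg_right hab (by positivity)
      linarith
    · linarith

lemma start_mem (hn : 3 ≤ n) {v : Bar} (hv : Valid n v) :
    0 ≤ (start n v).2 ∧ (start n v).2 < 2 * n + 3 := by
  match v, hv with
  | hub j, hv => simp only [start]; split_ifs <;> simp only <;> omega
  | path j i, hv => rw [valid_path] at hv; simp only [start]; split_ifs <;> simp only <;> omega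
  | extra k, hv => simp only [start]; split_ifs <;> simp only <;> omega

lemma finish_mem (hn : 3 ≤ n) {v : Bar} (hv : Valid n v) :
    0 ≤ (finish n v).2 ∧ (finish n v).2 < 2 * n + 3 := by
  match v, hv with
  | hub j, hv => simp only [finish]; split_ifs <;> simp only <;> omega
  | path j i, hv => rw [valid_path] at hv; simp only [finish]; split_ifs <;> simp only <;> omega
  | extra k, hv => simp only [finish]; split_ifs <;> simp only <;> omega

lemma start_le_finish (hn : 3 ≤ n) {v : Bar} (hv : Valid n v) :
    (start n v).1 < (finish n v).1 ∨ (start n v).1 = (finish n v).1 ∧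
      (start n v).2 ≤ (finish n v).2 := by
  match v, hv with
  | hub j, hv => rw [valid_hub] at hv; simp only [start, finish]; split_ifs <;> grind
  | path j i, hv =>
    rw [valid_path] at hv; simp only [start, finish]; split_ifs <;> grind
  | extra k, hv => simp only [start, finish]; split_ifs <;> grind

end Bar

/-! ### The contents of a column in terms of linear arithmetic. -/

namespace Bar

variable {n : ℕ}

/-- Two bars that are consecutive in some column. -/
def Meet (n : ℕ) (u v : Bar) : Prop :=
  ∃ J τ : ℤ, 0 ≤ τ ∧ τ < 2 * n + 3 ∧ Active n u J τ ∧ Active n v J τ ∧ height n u ≠ height n v ∧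
    ∀ w, Valid n w → Active n w J τ →
      height n w ≤ height n u ∧ height n w ≤ height n v ∨
        height n u ≤ height n w ∧ height n v ≤ height n w

/-- The possible heights of the bars in the column `τ` of the block `J`. -/
inductive Present (n : ℕ) (J τ : ℤ) : ℤ → Prop
  | bottom : Present n J τ 0
  | hub_zero (h : 0 ≤ J ∧ J ≤ 3 ∧ (J = 3 → τ = 0)) : Present n J τ (60 * n + 51)
  | hub_last (h : -1 ≤ J ∧ J ≤ 6 * n + 4 ∧ (J = -1 → 2 * n + 1 ≤ τ)) : Present n J τ (60 * n + 53)
  | hub_one (h : -1 ≤ J ∧ J ≤ 1 ∧ (J = -1 → 2 * n ≤ τ)) : Present n J τ 4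
  | hub (k y : ℤ) (h : (k % 2 = 1 ∧ y = 3 + k ∨ k % 2 = 0 ∧ y = 60 * n + 50 - k) ∧ 2 ≤ k ∧
      k ≤ 6 * n + 3 ∧ (k = J ∧ (6 * n + 2 ≤ J → τ ≤ 2 * n) ∨ k = J + 1 ∨
        k = J + 2 ∧ 2 * n + 1 ≤ τ)) : Present n J τ y
  | path_last (h : -1 ≤ J ∧ (J = -1 → 2 * n ≤ τ) ∧ (J < 6 * n + 5 ∨ J = 6 * n + 5 ∧ τ ≤ 3)) :
      Present n J τ (60 * n + 54)
  | path (k : ℤ) (h : 0 ≤ J ∧ J ≤ 6 * n + 4 ∧ 0 ≤ k ∧ k < n ∧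
      (J = 3 ∨ J = 6 * n + 4 → k < n - 1) ∧ 2 * k + 1 ≤ τ ∧
      (τ ≤ 2 * k + 3 ∨ J = 6 * n + 4 ∧ k = n - 2)) : Present n J τ (24 * n + 20 + k)
  | path_last' (h : J = 6 * n + 5 ∧ τ ≤ 1) : Present n J τ (25 * n + 18)
  | extra_zero (h : -1 ≤ J ∧ (J = -1 → 2 * n + 2 ≤ τ) ∧
      (J < 6 * n + 2 ∨ J = 6 * n + 2 ∧ τ ≤ 1)) : Present n J τ (60 * n + 52)
  | extra_one (h : 11 ≤ J ∧ (J = 11 → 1 ≤ τ) ∧ (J < 6 * n + 3 ∨ J = 6 * n + 3 ∧ τ ≤ 1)) :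
      Present n J τ 1
  | extra_two (h : 5 ≤ J ∧ (J = 5 → 1 ≤ τ) ∧ J ≤ 10) : Present n J τ 2
  | extra_three (h : J = 2 ∧ τ ≤ 0) : Present n J τ (24 * n + 19)

lemma present_hub {j : ℕ} (hv : Valid n (hub j)) {J τ : ℤ} (hτ : 0 ≤ τ)
    (hτ' : τ < 2 * n + 3) (h : Active n (hub j) J τ) : Present n J τ (height n (hub j)) := by
  rw [valid_hub] at hv
  obtain ⟨h1, h2⟩ := h
  simp only [start] at h1
  simp only [finish] at h2
  simp only [height]
  by_cases hj : j = 6 * n + 5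
  · rw [if_pos hj]
    exact .bottom
  rw [if_neg hj] at h1 h2 ⊢
  by_cases hj0 : j = 0
  · rw [if_pos hj0] at h1 h2 ⊢
    exact .hub_zero (by omega)
  rw [if_neg hj0] at h1 h2 ⊢
  by_cases hj4 : j = 6 * n + 4
  · rw [if_pos hj4] at h1 ⊢
    rw [if_pos (Or.inl hj4)] at h2
    exact .hub_last (by omega)
  rw [if_neg hj4] at h1 ⊢
  by_cases hj1 : j = 1
  · rw [if_pos hj1] at h1
    rw [if_pos (by omega)] at h2
    rw [if_pos (by omega), show (3 + j : ℤ) = 4 by omega]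
    exact .hub_one (by omega)
  rw [if_neg hj1] at h1
  refine .hub j _ ⟨?_, by omega, by omega, ?_⟩
  · split_ifs <;> omega
  · split_ifs at h2 <;> simp only at h1 h2 <;> omega

lemma present_path {j i : ℕ} (hv : Valid n (path j i)) {J τ : ℤ} (hn : 3 ≤ n)
    (hτ' : τ < 2 * n + 3) (h : Active n (path j i) J τ) :
    Present n J τ (height n (path j i)) := by
  rw [valid_path] at hv
  obtain ⟨h1, h2⟩ := h
  simp only [start] at h1
  simp only [finish] at h2
  simp only [height]
  by_cases hj : j = 6 * n + 4 ∧ i = 1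
  · rw [if_pos hj] at h1 h2 ⊢
    exact .path_last (by omega)
  rw [if_neg hj] at h1 h2 ⊢
  by_cases hJ : J = 6 * n + 5
  · have hi : j = 6 * n + 4 ∧ i = 2 := by
      split_ifs at h2 with h3
      · exact h3
      · simp only at h1 h2
        omega
    rw [if_pos hi] at h2
    rw [show (24 * n + 20 + (n - i) : ℤ) = 25 * n + 18 by omega]
    exact .path_last' (by omega)
  · have hJj : J = j := by split_ifs at h2 <;> simp only at h1 h2 <;> omega
    refine .path _ ⟨by omega, by omega, by omega, by omega, by omega, by omega, ?_⟩
    split_ifs at h2 <;> simp only at h1 h2 <;> omega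

lemma present_extra {k : ℕ} {J τ : ℤ} (h : Active n (extra k) J τ) :
    Present n J τ (height n (extra k)) := by
  obtain ⟨h1, h2⟩ := h
  simp only [start] at h1
  simp only [finish] at h2
  simp only [height]
  by_cases hk0 : k = 0
  · rw [if_pos hk0] at h1 h2 ⊢
    exact .extra_zero (by omega)
  rw [if_neg hk0] at h1 h2 ⊢
  by_cases hk1 : k = 1
  · rw [if_pos hk1] at h1 h2 ⊢
    exact .extra_one (by omega)
  rw [if_neg hk1] at h1 h2 ⊢
  by_cases hk2 : k = 2
  · rw [if_pos hk2] at h1 h2 ⊢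
    exact .extra_two (by omega)
  rw [if_neg hk2] at h1 h2 ⊢
  exact .extra_three (by omega)

lemma present (hn : 3 ≤ n) {v : Bar} (hv : Valid n v) {J τ : ℤ} (hτ : 0 ≤ τ)
    (hτ' : τ < 2 * n + 3) (h : Active n v J τ) : Present n J τ (height n v) := by
  match v, hv with
  | Bar.hub j, hv => exact present_hub hv hτ hτ' h
  | Bar.path j i, hv => exact present_path hv hn hτ' h
  | extra k, hv => exact present_extra h

/-- With this every contact is verified by naming a column and running through the constructors of
`Present`. -/
lemma meet_of_present (hn : 3 ≤ n) {u v : Bar} (J τ a b : ℤ) (hu' : height n u = a)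
    (hv' : height n v = b) (hτ : 0 ≤ τ) (hτ' : τ < 2 * n + 3) (hu : Active n u J τ)
    (hv : Active n v J τ) (hab : a ≠ b)
    (h : ∀ y, Present n J τ y → y ≤ a ∧ y ≤ b ∨ a ≤ y ∧ b ≤ y) : Meet n u v := by
  subst hu' hv'
  exact ⟨J, τ, hτ, hτ', hu, hv, hab, fun w hw ha => h _ (present hn hw hτ hτ' ha)⟩

lemma height_hub {j : ℕ} (hj : j ≤ 6 * n + 5) : ∃ a, height n (hub j) = a ∧
    (j = 0 ∧ a = 60 * n + 51 ∨ j = 6 * n + 5 ∧ a = 0 ∨ j = 6 * n + 4 ∧ a = 60 * n + 53 ∨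
      0 < j ∧ j < 6 * n + 4 ∧ (j % 2 = 1 ∧ a = 3 + j ∨ j % 2 = 0 ∧ a = 60 * n + 50 - j)) := by
  refine ⟨_, rfl, ?_⟩
  simp only [height]; split_ifs <;> omega

lemma height_path {j i : ℕ} (h : ¬ (j = 6 * n + 4 ∧ i = 1)) :
    height n (path j i) = 24 * n + 20 + (n - i) := by simp [height, h]

lemma height_path_last : height n (path (6 * n + 4) 1) = 60 * n + 54 := by simp [height]

lemma active_hub {j : ℕ} {J τ : ℤ} (hτ : 0 ≤ τ) (hτ' : τ < 2 * n + 3)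
    (h : 2 ≤ j ∧ j < 6 * n + 4 ∧
        (J = j ∧ (6 * n + 2 ≤ J → τ ≤ 2 * n) ∨ J = j - 1 ∨ J = j - 2 ∧ 2 * n + 1 ≤ τ) ∨
      j = 0 ∧ 0 ≤ J ∧ (J < 3 ∨ J = 3 ∧ τ = 0) ∨
      j = 1 ∧ (0 ≤ J ∧ J ≤ 1 ∨ J = -1 ∧ 2 * n ≤ τ) ∨
      j = 6 * n + 4 ∧ (0 ≤ J ∧ J ≤ 6 * n + 4 ∨ J = -1 ∧ 2 * n + 1 ≤ τ) ∨
      j = 6 * n + 5 ∧ -2 < J ∧ J < 6 * n + 6) :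
    Active n (hub j) J τ := by
  simp only [Active, start, finish]; split_ifs <;> dsimp only <;> omega

lemma active_path {j i : ℕ} {J τ : ℤ} (h : ¬ (j = 6 * n + 4 ∧ i = 1)) (hJ : J = j)
    (hτ : 2 * (n - i) + 1 ≤ τ) (hτ' : τ ≤ 2 * (n - i) + 3) : Active n (path j i) J τ := by
  simp only [Active, start, finish]; split_ifs <;> dsimp only <;> omega

lemma active_path_last {J τ : ℤ} (h : 0 ≤ J ∧ J ≤ 6 * n + 4 ∨ J = 6 * n + 5 ∧ τ ≤ 3 ∨
    J = -1 ∧ 2 * n ≤ τ) : Active n (path (6 * n + 4) 1) J τ := by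
  simp [Active, start, finish]; omega

end Bar

/-! ### The contacts between the bars. -/

namespace Bar

variable {n : ℕ}

lemma meet_hub_path (hn : 3 ≤ n) {j i : ℕ} (hv : Valid n (path j i)) :
    Meet n (hub j) (path j i) := by
  rw [valid_path] at hv
  obtain ⟨a, ha, h⟩ := height_hub (n := n) (j := j) (by omega)
  by_cases hs : j = 6 * n + 4 ∧ i = 1
  · obtain ⟨rfl, rfl⟩ := hs
    refine meet_of_present hn 0 0 _ _ ha height_path_last (by omega) (by omega)
      (active_hub (by omega) (by omega) (by omega)) (active_path_last (by omega)) (by omega)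
      fun y hy => ?_
    cases hy <;> omega
  -- In the middle one of its three columns an ordinary path bar has no other path bar of its block
  -- in the middle range, so it sees the hubs on both sides.
  · refine meet_of_present hn j (2 * (n - i) + 2) _ _ ha (height_path hs) (by omega) (by omega)
      (active_hub (by omega) (by omega) (by omega)) (active_path hs rfl (by omega) (by omega))
      (by omega) fun y hy => ?_
    cases hy <;> omega

lemma meet_path_hub (hn : 3 ≤ n) {j i : ℕ} (hv : Valid n (path j i)) :
    Meet n (path j i) (hub (j + 1)) := by
  rw [valid_path] at hv
  obtain ⟨a, ha, h⟩ := height_hub (n := n) (j := j + 1) (by omega)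
  by_cases hs : j = 6 * n + 4 ∧ i = 1
  · obtain ⟨rfl, rfl⟩ := hs
    refine meet_of_present hn (6 * n + 5) 2 _ _ height_path_last ha (by omega) (by omega)
      (active_path_last (by omega)) (active_hub (by omega) (by omega) (by omega)) (by omega)
      fun y hy => ?_
    cases hy <;> omega
  · refine meet_of_present hn j (2 * (n - i) + 2) _ _ (height_path hs) ha (by omega) (by omega)
      (active_path hs rfl (by omega) (by omega)) (active_hub (by omega) (by omega) (by omega))
      (by omega) fun y hy => ?_
    cases hy <;> omega

lemma meet_path_path (hn : 3 ≤ n) {j i : ℕ} (hv : Valid n (path j i))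
    (hv' : Valid n (path j (i + 1))) : Meet n (path j i) (path j (i + 1)) := by
  rw [valid_path] at hv hv'
  have hs' : ¬ (j = 6 * n + 4 ∧ i + 1 = 1) := by omega
  by_cases hs : j = 6 * n + 4 ∧ i = 1
  · obtain ⟨rfl, rfl⟩ := hs
    refine meet_of_present hn (6 * n + 5) 0 _ _ height_path_last (height_path hs') (by omega)
      (by omega) (active_path_last (by omega)) ?_ (by omega) fun y hy => ?_
    · simp [Active, start, finish]
    · cases hy <;> omega
  · refine meet_of_present hn j (2 * (n - i) + 1) _ _ (height_path hs) (height_path hs') (by omega)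
      (by omega) (active_path hs rfl (by omega) (by omega))
      (active_path hs' rfl (by omega) (by omega)) (by omega) fun y hy => ?_
    cases hy <;> omega

/-- The last column of a block has no ordinary path bar, so the hubs `j` and `j + 1` face each other
freely there. -/
lemma meet_hub_hub_succ (hn : 3 ≤ n) {j : ℕ} (hj : j < 6 * n + 5) :
    Meet n (hub j) (hub (j + 1)) := by
  obtain ⟨a, ha, h⟩ := height_hub (n := n) (j := j) (by omega)
  obtain ⟨b, hb, h'⟩ := height_hub (n := n) (j := j + 1) (by omega)
  by_cases hs : j = 0
  · subst hs
    refine meet_of_present hn 0 0 _ _ ha hb (by omega) (by omega)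
      (active_hub (by omega) (by omega) (by omega)) (active_hub (by omega) (by omega) (by omega))
      (by omega) fun y hy => ?_
    cases hy <;> omega
  · refine meet_of_present hn (j - 1) (2 * n + 2) _ _ ha hb (by omega) (by omega)
      (active_hub (by omega) (by omega) (by omega)) (active_hub (by omega) (by omega) (by omega))
      (by omega) fun y hy => ?_
    cases hy <;> omega

lemma meet_hub_hub_add_two (hn : 3 ≤ n) {j : ℕ} (hj : j < 6 * n + 4) :
    Meet n (hub j) (hub (j + 2)) := by
  obtain ⟨a, ha, h⟩ := height_hub (n := n) (j := j) (by omega)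
  obtain ⟨b, hb, h'⟩ := height_hub (n := n) (j := j + 2) (by omega)
  by_cases hs : j < 6 * n + 2
  · refine meet_of_present hn j (2 * n + 2) _ _ ha hb (by omega) (by omega)
      (active_hub (by omega) (by omega) (by omega)) (active_hub (by omega) (by omega) (by omega))
      (by omega) fun y hy => ?_
    cases hy <;> omega
  -- The partner is now the high bar `hub (6 n + 4)` or the background; the bars `extra 0` and
  -- `extra 1`, which would intervene, end at place `1` of the respective block.
  · refine meet_of_present hn j (2 * n) _ _ ha hb (by omega) (by omega)
      (active_hub (by omega) (by omega) (by omega)) (active_hub (by omega) (by omega) (by omega))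
      (by omega) fun y hy => ?_
    cases hy <;> omega

lemma meet_hub_last_hub_one (hn : 3 ≤ n) : Meet n (hub (6 * n + 4)) (hub 1) := by
  obtain ⟨a, ha, h⟩ := height_hub (n := n) (j := 6 * n + 4) (by omega)
  obtain ⟨b, hb, h'⟩ := height_hub (n := n) (j := 1) (by omega)
  refine meet_of_present hn (-1) (2 * n + 1) _ _ ha hb (by omega) (by omega)
    (active_hub (by omega) (by omega) (by omega)) (active_hub (by omega) (by omega) (by omega))
    (by omega) fun y hy => ?_
  cases hy <;> omega

lemma meet_path_one_hub (hn : 3 ≤ n) {j : ℕ} (hj : j < 6 * n + 4) :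
    Meet n (path j 1) (hub (j + 2)) := by
  obtain ⟨b, hb, h'⟩ := height_hub (n := n) (j := j + 2) (by omega)
  have hs : ¬ (j = 6 * n + 4 ∧ 1 = 1) := by omega
  refine meet_of_present hn j (2 * n + 1) _ _ (height_path hs) hb (by omega) (by omega)
    (active_path hs rfl (by omega) (by omega)) (active_hub (by omega) (by omega) (by omega))
    (by omega) fun y hy => ?_
  cases hy <;> omega

lemma meet_path_last_hub_one (hn : 3 ≤ n) : Meet n (path (6 * n + 4) 1) (hub 1) := by
  obtain ⟨b, hb, h'⟩ := height_hub (n := n) (j := 1) (by omega)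
  refine meet_of_present hn (-1) (2 * n) _ _ height_path_last hb (by omega) (by omega)
    (active_path_last (by omega)) (active_hub (by omega) (by omega) (by omega))
    (by omega) fun y hy => ?_
  cases hy <;> omega

/-- The background, whose label is that of the missing path bar, meets three hubs. -/
lemma meet_bottom_hub (hn : 3 ≤ n) {j : ℕ} (hj : j = 3 ∨ j = 5 ∨ j = 11) :
    Meet n (hub (6 * n + 5)) (hub j) := by
  obtain ⟨a, ha, h⟩ := height_hub (n := n) (j := 6 * n + 5) (by omega)
  obtain ⟨b, hb, h'⟩ := height_hub (n := n) (j := j) (by omega)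
  -- The hubs 3 and 5 are met before any extra bar runs below them. The hub 11 is met in the
  -- one-column gap between the end of `extra 2` and the start of `extra 1`.
  refine meet_of_present hn (if j = 3 then 2 else if j = 5 then 4 else 11) 0 _ _ ha hb (by omega)
    (by omega) (active_hub (by omega) (by omega) (by omega))
    (active_hub (by omega) (by omega) (by omega)) (by omega) fun y hy => ?_
  rcases hj with rfl | rfl | rfl <;> simp at hy <;> cases hy <;> omega

lemma meet_hub_zero_hub_four (hn : 3 ≤ n) : Meet n (hub 0) (hub 4) := by
  obtain ⟨a, ha, h⟩ := height_hub (n := n) (j := 0) (by omega)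
  obtain ⟨b, hb, h'⟩ := height_hub (n := n) (j := 4) (by omega)
  refine meet_of_present hn 3 0 _ _ ha hb (by omega) (by omega)
    (active_hub (by omega) (by omega) (by omega)) (active_hub (by omega) (by omega) (by omega))
    (by omega) fun y hy => ?_
  cases hy <;> omega

lemma active_extra {k : ℕ} {J τ : ℤ} (hτ : 0 ≤ τ) (hτ' : τ < 2 * n + 3)
    (h : k = 0 ∧ (J = -1 ∧ τ = 2 * n + 2 ∨ 0 ≤ J ∧ J < 6 * n + 2) ∨
      k = 1 ∧ 11 ≤ J ∧ J ≤ 6 * n + 3 ∧ τ = 1 ∨ k = 2 ∧ 5 ≤ J ∧ J ≤ 10 ∧ τ = 1 ∨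
      k = 3 ∧ J = 2 ∧ τ = 0) : Active n (extra k) J τ := by
  simp only [Active, start, finish]; split_ifs <;> dsimp only <;> omega

/-- The bar `extra 0` runs above the even hubs from 4 on and also meets the hubs 0, 1 and `6 n + 4`.
The hub 0 hides the hub 2 from it, so `extra 3` lies between the hubs 2 and 3. The remaining odd
hubs are met from below, up to 9 by `extra 2` and from 11 on by `extra 1`. -/
lemma meet_extra_hub (hn : 3 ≤ n) {j : ℕ} (hj : j < 6 * n + 5) :
    ∃ k < 4, Meet n (extra k) (hub j) := by
  obtain ⟨b, hb, h'⟩ := height_hub (n := n) (j := j) (by omega)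
  have key : ∀ (k : ℕ) (J τ c : ℤ), height n (extra k) = c → 0 ≤ τ → τ < 2 * n + 3 →
      Active n (extra k) J τ → Active n (hub j) J τ → c ≠ b → k < 4 →
      (∀ y, Present n J τ y → y ≤ c ∧ y ≤ b ∨ c ≤ y ∧ b ≤ y) → ∃ k < 4, Meet n (extra k) (hub j) :=
    fun k J τ c h1 h2 h3 h4 h5 h6 h7 h8 => ⟨k, h7, meet_of_present hn J τ c b h1 hb h2 h3 h4 h5 h6 h8⟩
  have h0 : height n (extra 0) = 60 * n + 52 := by simp [height]
  have h1 : height n (extra 1) = 1 := by simp [height]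
  have h2 : height n (extra 2) = 2 := by simp [height]
  have h3 : height n (extra 3) = 24 * n + 19 := by simp [height]
  have hc : j = 0 ∨ (j = 1 ∨ j = 6 * n + 4) ∨ (j = 2 ∨ j = 3) ∨
    (4 ≤ j ∧ j < 6 * n + 3 ∧ j % 2 = 0) ∨ (5 ≤ j ∧ j ≤ 9 ∧ j % 2 = 1) ∨
    (11 ≤ j ∧ j ≤ 6 * n + 3 ∧ j % 2 = 1) := by omega
  rcases hc with h | h | h | h | h | h
  · refine key 0 0 0 _ h0 (by omega) (by omega) (active_extra (by omega) (by omega) (by omega))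
      (active_hub (by omega) (by omega) (by omega)) (by omega) (by omega) fun y hy => ?_
    cases hy <;> omega
  · refine key 0 (-1) (2 * n + 2) _ h0 (by omega) (by omega)
      (active_extra (by omega) (by omega) (by omega))
      (active_hub (by omega) (by omega) (by omega)) (by omega) (by omega) fun y hy => ?_
    cases hy <;> omega
  · refine key 3 2 0 _ h3 (by omega) (by omega) (active_extra (by omega) (by omega) (by omega))
      (active_hub (by omega) (by omega) (by omega)) (by omega) (by omega) fun y hy => ?_
    cases hy <;> omega
  · refine key 0 (j - 1) 1 _ h0 (by omega) (by omega)
      (active_extra (by omega) (by omega) (by omega))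
      (active_hub (by omega) (by omega) (by omega)) (by omega) (by omega) fun y hy => ?_
    cases hy <;> omega
  · refine key 2 j 1 _ h2 (by omega) (by omega) (active_extra (by omega) (by omega) (by omega))
      (active_hub (by omega) (by omega) (by omega)) (by omega) (by omega) fun y hy => ?_
    cases hy <;> omega
  · refine key 1 j 1 _ h1 (by omega) (by omega) (active_extra (by omega) (by omega) (by omega))
      (active_hub (by omega) (by omega) (by omega)) (by omega) (by omega) fun y hy => ?_
    cases hy <;> omega

end Bar

/-! ### The bar family, its labels and the size of its empires. -/

namespace Bar

variable {n : ℕ}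

/-- Only path bars reuse heights, and only from one block to another; this reduces `Bars.sep` to
comparing blocks. -/
lemma eq_or_of_height_eq (hn : 3 ≤ n) {v w : Bar} (hv : Valid n v) (hw : Valid n w)
    (h : height n v = height n w) : v = w ∨ ∃ j j' i, v = path j i ∧ w = path j' i ∧ j ≠ j' ∧
      ¬ (j = 6 * n + 4 ∧ i = 1) ∧ ¬ (j' = 6 * n + 4 ∧ i = 1) := by
  have hep : ∀ {k j i}, Valid n (extra k) → Valid n (path j i) →
      height n (extra k) ≠ height n (path j i) := by
    intro k j i hk hp h
    rw [valid_extra] at hk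
    rw [valid_path] at hp
    simp only [height] at h
    split_ifs at h <;> omega
  have hhp : ∀ {l j i}, Valid n (hub l) → Valid n (path j i) →
      height n (hub l) ≠ height n (path j i) := by
    intro l j i hl hp h
    rw [valid_path] at hp
    obtain ⟨a, ha, ha'⟩ := height_hub hl
    rw [ha] at h
    simp only [height] at h
    split_ifs at h <;> omega
  have hhe : ∀ {l k}, Valid n (hub l) → Valid n (extra k) →
      height n (hub l) ≠ height n (extra k) := by
    intro l k hl hk h
    rw [valid_extra] at hk
    obtain ⟨a, ha, ha'⟩ := height_hub hl
    rw [ha] at h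
    simp only [height] at h
    split_ifs at h <;> omega
  match v, w with
  | hub j, hub j' =>
    obtain ⟨a, ha, ha'⟩ := height_hub hv
    obtain ⟨b, hb, hb'⟩ := height_hub hw
    left
    rw [show j = j' by omega]
  | hub j, path j' i => exact absurd h (hhp hv hw)
  | hub j, extra k => exact absurd h (hhe hv hw)
  | path j i, hub j' => exact absurd h.symm (hhp hw hv)
  | path j i, path j' i' =>
    rw [valid_path] at hv hw
    simp only [height] at h
    by_cases hjj : j = j'
    · subst hjj
      left
      rw [show i = i' by split_ifs at h <;> omega]
    · right
      have h1 : i = i' ∧ ¬ (j = 6 * n + 4 ∧ i = 1) ∧ ¬ (j' = 6 * n + 4 ∧ i = 1) := by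
        split_ifs at h <;> omega
      obtain ⟨rfl, h1, h2⟩ := h1
      exact ⟨j, j', i, rfl, rfl, hjj, h1, h2⟩
  | path j i, extra k => exact absurd h.symm (hep hw hv)
  | extra k, hub j => exact absurd h.symm (hhe hw hv)
  | extra k, path j i => exact absurd h (hep hv hw)
  | extra k, extra k' =>
    rw [valid_extra] at hv hw
    left
    simp only [height] at h
    rw [show k = k' by split_ifs at h <;> omega]

lemma finish_lt_start {j j' i : ℕ} (h : j < j') (h' : j' < 6 * n + 5)
    (hs : ¬ (j' = 6 * n + 4 ∧ i = 1)) : (finish n (path j i)).1 < (start n (path j' i)).1 := by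
  simp only [start, finish]
  split_ifs <;> dsimp only <;> omega

/-- The number of a column given by its block and its place in the block. -/
def column (n : ℕ) (x : ℤ × ℤ) : ℤ := x.1 * (2 * n + 3) + x.2

lemma column_le_column {x y : ℤ × ℤ} (hx : 0 ≤ x.2 ∧ x.2 < 2 * n + 3)
    (hy : 0 ≤ y.2 ∧ y.2 < 2 * n + 3) :
    column n x ≤ column n y ↔ x.1 < y.1 ∨ x.1 = y.1 ∧ x.2 ≤ y.2 :=
  column_le_iff hx.1 hx.2 hy.1 hy.2

/-- The family of bars. -/
def bars (hn : 3 ≤ n) : Bars {v // Valid n v} where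
  l v := column n (start n v)
  e v := column n (finish n v) + 1
  y v := height n v
  b := ⟨hub (6 * n + 5), valid_hub.2 le_rfl⟩
  lt := fun ⟨v, hv⟩ => Int.lt_add_one_iff.2
    ((column_le_column (start_mem hn hv) (finish_mem hn hv)).2 (start_le_finish hn hv))
  b_lt := by
    rintro ⟨v, hv⟩ hne
    have h0 : height n (hub (6 * n + 5)) = 0 := by simp [height]
    have h1 : 0 ≤ height n v := by
      match v, hv with
      | hub j, hv =>
        obtain ⟨a, ha, ha'⟩ := height_hub hv
        omega
      | path j i, hv =>
        rw [valid_path] at hv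
        simp only [height]
        split_ifs <;> omega
      | extra k, hv =>
        simp only [height]
        split_ifs <;> omega
    have h2 : height n v ≠ 0 := by
      intro h
      rcases eq_or_of_height_eq hn hv (valid_hub.2 le_rfl) (h.trans h0.symm) with h | h
      · exact hne (Subtype.ext h)
      · obtain ⟨_, _, _, _, h, _⟩ := h
        cases h
    simp only [h0]
    omega
  l_b := by
    rintro ⟨v, hv⟩
    refine (column_le_column (start_mem hn (valid_hub.2 le_rfl)) (start_mem hn hv)).2 ?_
    have h0 : start n (hub (6 * n + 5)) = (-2, 0) := by simp [start]
    rw [h0]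
    match v, hv with
    | hub j, hv => simp only [start]; split_ifs <;> dsimp only <;> omega
    | path j i, hv => simp only [start]; split_ifs <;> dsimp only <;> omega
    | extra k, hv => simp only [start]; split_ifs <;> dsimp only <;> omega
  e_b := by
    rintro ⟨v, hv⟩
    refine Int.add_le_add_right
      ((column_le_column (finish_mem hn hv) (finish_mem hn (valid_hub.2 le_rfl))).2 ?_) 1
    have h0 : finish n (hub (6 * n + 5)) = ((6 * n + 6 : ℤ), 0) := by simp [finish]
    rw [h0]
    match v, hv with
    | hub j, hv =>
      rw [valid_hub] at hv
      simp only [finish]; split_ifs <;> dsimp only <;> omega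
    | path j i, hv =>
      rw [valid_path] at hv
      simp only [finish]; split_ifs <;> dsimp only <;> omega
    | extra k, hv => simp only [finish]; split_ifs <;> dsimp only <;> omega
  sep := by
    rintro ⟨v, hv⟩ ⟨w, hw⟩ hne h
    rcases eq_or_of_height_eq hn hv hw h with h | ⟨j, j', i, rfl, rfl, hj, h1, h2⟩
    · exact absurd (Subtype.ext h) hne
    have key : ∀ {j j' : ℕ}, Valid n (path j i) → Valid n (path j' i) → j < j' →
        ¬ (j' = 6 * n + 4 ∧ i = 1) →
        column n (finish n (path j i)) + 1 ≤ column n (start n (path j' i)) := by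
      intro j j' hv hw hj h2
      refine Int.add_one_le_iff.2 (lt_of_not_ge fun h => ?_)
      have h3 := (column_le_column (start_mem hn hw) (finish_mem hn hv)).1 h
      have h4 := finish_lt_start hj hw.1 h2
      omega
    rcases lt_or_gt_of_ne hj with hj | hj
    exacts [Or.inl (key hv hw hj h2), Or.inr (key hw hv hj h1)]

lemma Meet.touch (hn : 3 ≤ n) {u v : {v // Valid n v}} (h : Meet n u v) :
    (bars hn).Touch u v ∨ (bars hn).Touch v u := by
  obtain ⟨J, τ, hτ, hτ', hu, hv, hne, h⟩ := h
  have act : ∀ w : {v // Valid n v}, Active n w J τ ↔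
      (bars hn).l w ≤ column n (J, τ) ∧ column n (J, τ) < (bars hn).e w := by
    rintro ⟨w, hw⟩
    have h1 := column_le_column (x := start n w) (y := (J, τ)) (start_mem hn hw) ⟨hτ, hτ'⟩
    have h2 := column_le_column (x := (J, τ)) (y := finish n w) ⟨hτ, hτ'⟩ (finish_mem hn hw)
    simp only [bars, Int.lt_add_one_iff, h1, h2, Active]
  have hu' := (act u).1 hu
  have hv' := (act v).1 hv
  rcases lt_or_gt_of_ne hne with hlt | hlt
  · refine Or.inl ⟨_, hu'.1, hu'.2, hv'.1, hv'.2, hlt, fun w h1 h2 => ?_⟩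
    rcases h w w.2 ((act w).2 ⟨h1, h2⟩) with h | h
    exacts [Or.inl h.1, Or.inr h.2]
  · refine Or.inr ⟨_, hv'.1, hv'.2, hu'.1, hu'.2, hlt, fun w h1 h2 => ?_⟩
    rcases h w w.2 ((act w).2 ⟨h1, h2⟩) with h | h
    exacts [Or.inl h.2, Or.inr h.1]

lemma Meet.symm {u v : Bar} (h : Meet n u v) : Meet n v u := by
  obtain ⟨J, τ, hτ, hτ', hu, hv, hne, h⟩ := h
  exact ⟨J, τ, hτ, hτ', hv, hu, hne.symm, fun w hw ha => (h w hw ha).imp And.symm And.symm⟩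

/-- A zigzag through the interval from `2 n + 3` to `3 n + 2`, in which the differences of
consecutive terms are `n - 1, n - 2, …, 1`. -/
def zigzag (n i : ℕ) : ℕ := if i % 2 = 1 then 3 * n + 2 - i / 2 else 2 * n + 2 + i / 2

variable (n) in
/-- The empire of a bar. -/
def label : Bar → Option (ZMod (6 * n + 5))
  | hub j => some (j * (n + 1))
  | path j i => some (j * (n + 1) + zigzag n i)
  | extra _ => none

variable (n) in
/-- The number of a bar in its empire. -/
def slot : Bar → ℕ
  | hub j => if j = 6 * n + 5 then 1 else 0
  | path _ i => i
  | extra k => k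

variable (n) in
lemma modulus_eq_zero : (6 * n + 5 : ZMod (6 * n + 5)) = 0 := by
  have := ZMod.natCast_self (6 * n + 5)
  push_cast at this
  exact this

/-- Modulo `6 n + 5` the inverse of `n + 1` is `6`. -/
lemma exists_hub_label (a : ZMod (6 * n + 5)) :
    ∃ j < 6 * n + 5, (j * (n + 1) : ZMod (6 * n + 5)) = a := by
  refine ⟨(6 * a).val, ZMod.val_lt _, ?_⟩
  rw [ZMod.natCast_zmod_val]
  linear_combination a * modulus_eq_zero n

lemma hub_label_injective {j j' : ℕ} (hj : j < 6 * n + 5) (hj' : j' < 6 * n + 5)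
    (h : (j * (n + 1) : ZMod (6 * n + 5)) = j' * (n + 1)) : j = j' := by
  have h1 : (j : ZMod (6 * n + 5)) = j' := by
    linear_combination 6 * h - (j - j' : ZMod (6 * n + 5)) * modulus_eq_zero n
  rw [ZMod.natCast_eq_natCast_iff'] at h1
  rwa [Nat.mod_eq_of_lt hj, Nat.mod_eq_of_lt hj'] at h1

lemma slot_lt (hn : 3 ≤ n) {v : Bar} (hv : Valid n v) : slot n v < n + 1 := by
  match v, hv with
  | hub j, hv => simp only [slot]; split_ifs <;> omega
  | path j i, hv => rw [valid_path] at hv; simp only [slot]; omega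
  | extra k, hv => rw [valid_extra] at hv; simp only [slot]; omega

lemma path_one_label_ne {j : ℕ} (hv : Valid n (path j 1)) :
    (j * (n + 1) + zigzag n 1 : ZMod (6 * n + 5)) ≠ 0 := by
  intro h
  rw [valid_path] at hv
  have hz : zigzag n 1 = 3 * n + 2 := by simp [zigzag]
  rw [hz] at h
  push_cast at h
  refine hv.2.2.2 ⟨hub_label_injective hv.1 (by omega) ?_, rfl⟩
  push_cast
  linear_combination h - modulus_eq_zero n

/-- An empire has one bar for each slot, which bounds its size. The background has slot `1` in the
empire `0`, left vacant by `path 3 1`. -/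
lemma label_slot_injective {v w : Bar} (hv : Valid n v) (hw : Valid n w)
    (h : label n v = label n w) (h' : slot n v = slot n w) : v = w := by
  have hhp : ∀ {l j i}, Valid n (hub l) → Valid n (path j i) →
      label n (hub l) = label n (path j i) → slot n (hub l) ≠ slot n (path j i) := by
    intro l j i hl hp h h'
    simp only [slot] at h'
    have hp' := valid_path.1 hp
    split_ifs at h' with hlN
    · subst h'
      refine path_one_label_ne hp ?_
      rw [← Option.some_injective _ h, hlN]
      push_cast
      linear_combination (n + 1 : ZMod (6 * n + 5)) * modulus_eq_zero n
    · omega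
  match v, w with
  | hub j, hub j' =>
    rw [valid_hub] at hv hw
    simp only [slot] at h'
    have : j = j' := by
      split_ifs at h' with h1 h2 h2
      · omega
      · exact hub_label_injective (by omega) (by omega) (Option.some_injective _ h)
    rw [this]
  | hub j, path j' i => exact absurd h' (hhp hv hw h)
  | hub j, extra k => cases h
  | path j i, hub j' => exact absurd h'.symm (hhp hw hv h.symm)
  | path j i, path j' i' =>
    obtain rfl : i = i' := h'
    rw [hub_label_injective hv.1 hw.1 (add_right_cancel (Option.some_injective _ h))]
  | path j i, extra k => cases h
  | extra k, hub j => cases h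
  | extra k, path j i => cases h
  | extra k, extra k' => exact congrArg extra h'

lemma isMPire_label (hn : 3 ≤ n) : IsMPire (n + 1) fun v : {v // Valid n v} => label n v := by
  intro a
  have h1 : ((fun v : {v // Valid n v} => label n v) ⁻¹' {a}).encard ≤
      ((Finset.range (n + 1) : Finset ℕ) : Set ℕ).encard := by
    refine Set.encard_le_encard_of_injOn (f := fun v => slot n v) ?_ ?_
    · rintro ⟨v, hv⟩ _
      simpa using slot_lt hn hv
    · rintro ⟨v, hv⟩ h ⟨w, hw⟩ h' hvw
      exact Subtype.ext (label_slot_injective hv hw (h.trans h'.symm) hvw)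
  rwa [Set.encard_coe_eq_coe_finsetCard, Finset.card_range] at h1

end Bar

/-! ### Every difference of labels occurs. -/

namespace Bar

variable {n : ℕ}

/-- Odd `i` give the upper half of the interval in descending order, even `i` the lower half in
ascending order. -/
lemma exists_zigzag {d : ℕ} (h : 2 * n + 3 ≤ d) (h' : d ≤ 3 * n + 2) :
    ∃ i, 1 ≤ i ∧ i ≤ n ∧ zigzag n i = d := by
  by_cases hd : 2 * (3 * n + 2 - d) + 1 ≤ n
  · refine ⟨2 * (3 * n + 2 - d) + 1, by omega, hd, ?_⟩
    simp only [zigzag]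
    split_ifs <;> omega
  · refine ⟨2 * (d - (2 * n + 2)), by omega, by omega, ?_⟩
    simp only [zigzag]
    split_ifs <;> omega

lemma label_bottom : label n (hub (6 * n + 5)) = some 0 := by
  rw [label]
  congr 1
  push_cast
  linear_combination (n + 1 : ZMod (6 * n + 5)) * modulus_eq_zero n

/-- Two labels that occur on consecutive bars. -/
def LabelsMeet (n : ℕ) (a b : Option (ZMod (6 * n + 5))) : Prop :=
  ∃ u v, Valid n u ∧ Valid n v ∧ label n u = a ∧ label n v = b ∧ Meet n u v

lemma LabelsMeet.symm {a b : Option (ZMod (6 * n + 5))} (h : LabelsMeet n a b) :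
    LabelsMeet n b a := by
  obtain ⟨u, v, hu, hv, h1, h2, h⟩ := h
  exact ⟨v, u, hv, hu, h2, h1, h.symm⟩

lemma labelsMeet_path_hub (hn : 3 ≤ n) (a : ZMod (6 * n + 5)) {i : ℕ} (hi : 1 ≤ i)
    (hi' : i ≤ n) : LabelsMeet n (some a) (some (a + zigzag n i)) := by
  obtain ⟨j, hj, rfl⟩ := exists_hub_label a
  by_cases h3 : j = 3 ∧ i = 1
  · obtain ⟨rfl, rfl⟩ := h3
    refine LabelsMeet.symm ⟨hub (6 * n + 5), hub 3, valid_hub.2 le_rfl, valid_hub.2 (by omega),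
      ?_, rfl, meet_bottom_hub hn (by omega)⟩
    rw [label_bottom, show zigzag n 1 = 3 * n + 2 by simp [zigzag]]
    push_cast
    congr 1
    linear_combination - modulus_eq_zero n
  · have hv : Valid n (path j i) := ⟨hj, hi, hi', h3⟩
    exact ⟨hub j, path j i, valid_hub.2 hj.le, hv, rfl, rfl, meet_hub_path hn hv⟩

lemma labelsMeet_path_hub_succ (hn : 3 ≤ n) (a : ZMod (6 * n + 5)) {i : ℕ} (hi : 1 ≤ i)
    (hi' : i ≤ n) : LabelsMeet n (some (a + (n + 1))) (some (a + zigzag n i)) := by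
  obtain ⟨j, hj, rfl⟩ := exists_hub_label a
  by_cases h3 : j = 3 ∧ i = 1
  · obtain ⟨rfl, rfl⟩ := h3
    -- The hub 0 shares the label `0` of the missing `path 3 1`, so it can supply the contact with
    -- the hub 4.
    refine LabelsMeet.symm ⟨hub 0, hub 4, valid_hub.2 (by omega), valid_hub.2 (by omega),
      ?_, ?_, meet_hub_zero_hub_four hn⟩
    · rw [label, show zigzag n 1 = 3 * n + 2 by simp [zigzag]]
      push_cast
      congr 1
      linear_combination - modulus_eq_zero n
    · rw [label]
      push_cast
      congr 1
      ring
  · have hv : Valid n (path j i) := ⟨hj, hi, hi', h3⟩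
    refine LabelsMeet.symm ⟨path j i, hub (j + 1), hv, valid_hub.2 (by omega), rfl, ?_,
      meet_path_hub hn hv⟩
    rw [label]
    push_cast
    congr 1
    ring

lemma labelsMeet_path_path (hn : 3 ≤ n) (a : ZMod (6 * n + 5)) {i : ℕ} (hi : 1 ≤ i)
    (hi' : i < n) : LabelsMeet n (some (a + zigzag n i)) (some (a + zigzag n (i + 1))) := by
  obtain ⟨j, hj, rfl⟩ := exists_hub_label a
  by_cases h3 : j = 3 ∧ i = 1
  · obtain ⟨rfl, rfl⟩ := h3
    -- The label of `path 3 2` is `5 n + 6`, which is also `11 (n + 1)`, the label of the hub 11.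
    refine ⟨hub (6 * n + 5), hub 11, valid_hub.2 le_rfl, valid_hub.2 (by omega), ?_, ?_,
      meet_bottom_hub hn (by omega)⟩
    · rw [label_bottom, show zigzag n 1 = 3 * n + 2 by simp [zigzag]]
      push_cast
      congr 1
      linear_combination - modulus_eq_zero n
    · rw [label, show zigzag n (1 + 1) = 2 * n + 3 by simp [zigzag]]
      push_cast
      congr 1
      linear_combination modulus_eq_zero n
  · have hv : Valid n (path j i) := ⟨hj, hi, hi'.le, h3⟩
    have hv' : Valid n (path j (i + 1)) := ⟨hj, by omega, by omega, by omega⟩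
    exact ⟨path j i, path j (i + 1), hv, hv', rfl, rfl, meet_path_path hn hv hv'⟩

lemma labelsMeet_hub_succ (hn : 3 ≤ n) (a : ZMod (6 * n + 5)) :
    LabelsMeet n (some a) (some (a + (n + 1))) := by
  obtain ⟨j, hj, rfl⟩ := exists_hub_label a
  refine ⟨hub j, hub (j + 1), valid_hub.2 hj.le, valid_hub.2 hj, rfl, ?_, meet_hub_hub_succ hn hj⟩
  rw [label]
  push_cast
  congr 1
  ring

/-- By periodicity the hub 1 also serves as hub `6 n + 6`, which closes the cycle of hubs. -/
lemma label_hub_one : label n (hub 1) =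
    some (((6 * n + 4 : ℕ) : ZMod (6 * n + 5)) * (n + 1) + 2 * (n + 1)) := by
  rw [label]
  push_cast
  congr 1
  linear_combination - (n + 1 : ZMod (6 * n + 5)) * modulus_eq_zero n

lemma labelsMeet_hub_add_two (hn : 3 ≤ n) (a : ZMod (6 * n + 5)) :
    LabelsMeet n (some a) (some (a + 2 * (n + 1))) := by
  obtain ⟨j, hj, rfl⟩ := exists_hub_label a
  rcases Nat.lt_or_eq_of_le (Nat.le_of_lt_succ hj) with h | rfl
  · refine ⟨hub j, hub (j + 2), valid_hub.2 hj.le, valid_hub.2 (by omega), rfl, ?_,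
      meet_hub_hub_add_two hn h⟩
    rw [label]
    push_cast
    congr 1
    ring
  · exact ⟨hub (6 * n + 4), hub 1, valid_hub.2 hj.le, valid_hub.2 (by omega), rfl, label_hub_one,
      meet_hub_last_hub_one hn⟩

lemma labelsMeet_path_one_hub (hn : 3 ≤ n) (a : ZMod (6 * n + 5)) :
    LabelsMeet n (some (a + 2 * (n + 1))) (some (a + zigzag n 1)) := by
  obtain ⟨j, hj, rfl⟩ := exists_hub_label a
  refine LabelsMeet.symm ?_
  by_cases h3 : j = 3
  · subst h3
    refine ⟨hub (6 * n + 5), hub 5, valid_hub.2 le_rfl, valid_hub.2 (by omega), ?_, ?_,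
      meet_bottom_hub hn (by omega)⟩
    · rw [label_bottom, show zigzag n 1 = 3 * n + 2 by simp [zigzag]]
      push_cast
      congr 1
      linear_combination - modulus_eq_zero n
    · rw [label]
      push_cast
      congr 1
      ring
  have hv : Valid n (path j 1) := ⟨hj, le_rfl, by omega, by omega⟩
  rcases Nat.lt_or_eq_of_le (Nat.le_of_lt_succ hj) with h | rfl
  · refine ⟨path j 1, hub (j + 2), hv, valid_hub.2 (by omega), rfl, ?_, meet_path_one_hub hn h⟩
    rw [label]
    push_cast
    congr 1
    ring
  · exact ⟨path (6 * n + 4) 1, hub 1, hv, valid_hub.2 (by omega), rfl, label_hub_one,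
      meet_path_last_hub_one hn⟩

/-- The differences from `2 n + 3` to `3 n + 2` are the zigzag values (hub-path), and subtracting `n
+ 1` gives those from `n + 2` to `2 n + 1` (path-next hub). Consecutive zigzag terms give those
below `n`. The steps `n + 1` and `2 n + 2` occur between hubs, and `n = (3 n + 2) - 2 (n + 1)`
between a first path bar and the second next hub. -/
lemma labelsMeet_add (hn : 3 ≤ n) (a : ZMod (6 * n + 5)) {d : ℕ} (hd : 1 ≤ d)
    (hd' : d ≤ 3 * n + 2) : LabelsMeet n (some a) (some (a + d)) := by
  have hc : 2 * n + 3 ≤ d ∨ d = 2 * n + 2 ∨ n + 2 ≤ d ∧ d ≤ 2 * n + 1 ∨ d = n + 1 ∨ d = n ∨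
    d < n := by omega
  rcases hc with h | rfl | h | rfl | rfl | h
  · obtain ⟨i, hi, hi', rfl⟩ := exists_zigzag h hd'
    exact labelsMeet_path_hub hn a hi hi'
  · convert labelsMeet_hub_add_two hn a using 3
    push_cast
    ring
  · obtain ⟨i, hi, hi', hz⟩ := exists_zigzag (n := n) (d := d + (n + 1)) (by omega) (by omega)
    have := labelsMeet_path_hub_succ hn (a - (n + 1)) hi hi'
    rw [hz] at this
    convert this using 2
    · ring
    · push_cast
      ring
  · convert labelsMeet_hub_succ hn a using 3
    push_cast
    ring
  · have := labelsMeet_path_one_hub hn (a - 2 * (d + 1))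
    rw [show zigzag d 1 = 3 * d + 2 by simp [zigzag]] at this
    convert this using 2
    · ring
    · push_cast
      ring
  · obtain ⟨i, hi, rfl⟩ : ∃ i, 1 ≤ i ∧ d = n - i := ⟨n - d, by omega, by omega⟩
    rcases Nat.mod_two_eq_zero_or_one i with hi2 | hi2
    · have hz : zigzag n (i + 1) = zigzag n i + (n - i) := by
        simp only [zigzag]
        split_ifs <;> omega
      have := labelsMeet_path_path hn (a - zigzag n i) hi (by omega)
      rw [hz, Nat.cast_add, sub_add_cancel, ← add_assoc, sub_add_cancel] at this
      exact this
    · have hz : zigzag n i = zigzag n (i + 1) + (n - i) := by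
        simp only [zigzag]
        split_ifs <;> omega
      have := (labelsMeet_path_path hn (a - zigzag n (i + 1)) hi (by omega)).symm
      rw [hz, Nat.cast_add, sub_add_cancel, ← add_assoc, sub_add_cancel] at this
      exact this

lemma labelsMeet (hn : 3 ≤ n) {a b : Option (ZMod (6 * n + 5))} (hab : a ≠ b) :
    LabelsMeet n a b := by
  have hx : ∀ a : ZMod (6 * n + 5), LabelsMeet n none (some a) := by
    intro a
    obtain ⟨j, hj, rfl⟩ := exists_hub_label a
    obtain ⟨k, hk, h⟩ := meet_extra_hub hn hj
    exact ⟨extra k, hub j, hk, valid_hub.2 hj.le, rfl, rfl, h⟩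
  match a, b with
  | none, none => exact absurd rfl hab
  | none, some b => exact hx b
  | some a, none => exact (hx a).symm
  | some a, some b =>
    have hne : b - a ≠ 0 := fun h => hab (congrArg some (sub_eq_zero.1 h).symm)
    have h1 : (b - a).val ≠ 0 := fun h => hne ((ZMod.val_eq_zero _).1 h)
    have h2 := ZMod.val_lt (b - a)
    have h3 : (((b - a).val : ℕ) : ZMod (6 * n + 5)) = b - a := ZMod.natCast_zmod_val _
    -- One of `b - a` and `a - b` has its representative in the range from `1` to `3 n + 2`.
    rcases Nat.lt_or_ge (3 * n + 2) (b - a).val with h | h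
    · have := labelsMeet_add hn b (d := 6 * n + 5 - (b - a).val) (by omega) (by omega)
      rw [Nat.cast_sub h2.le, h3, ZMod.natCast_self] at this
      convert this.symm using 2
      ring
    · have := labelsMeet_add hn a (d := (b - a).val) (by omega) h
      rw [h3] at this
      convert this using 2
      ring

/-- For `m ≥ 4` there is an `m`-pire map that needs `6 m` colours. -/
theorem exists_empireMap (hn : 3 ≤ n) : ∃ (k : ℕ) (M : SphereMap (Fin k))
    (h : Fin k → Fin (6 * (n + 1))), IsMPire (n + 1) h ∧
      (∀ a b, a ≠ b → (M.empireGraph h).Adj a b) ∧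
      (M.empireGraph h).chromaticNumber = ((6 * (n + 1) : ℕ) : ℕ∞) := by
  have := finite_valid (n := n)
  have hcard : Fintype.card (Option (ZMod (6 * n + 5))) = 6 * (n + 1) := by
    rw [Fintype.card_option, ZMod.card]
    ring
  let φ := Fintype.equivFinOfCardEq hcard
  refine (bars hn).exists_empireMap (fun v => φ (label n v)) (fun a => ?_) fun a b hab => ?_
  · convert isMPire_label hn (φ.symm a) using 2
    ext v
    simp [Equiv.eq_symm_apply]
  · obtain ⟨u, v, hu, hv, h1, h2, h⟩ := labelsMeet hn (φ.symm.injective.ne hab)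
    refine ⟨⟨u, hu⟩, ⟨v, hv⟩, ?_, ?_, Meet.touch hn (u := ⟨u, hu⟩) (v := ⟨v, hv⟩) h⟩
    · simp [h1]
    · simp [h2]

end Bar

theorem mainTheorem1 (m : ℕ) (hm : 2 ≤ m) :
    (∀ (ι A : Type*) [Finite ι] (M : SphereMap ι) (h : ι → A), IsMPire m h →
      (M.empireGraph h).Colorable (6 * m)) ∧
    (∃ (n : ℕ) (M : SphereMap (Fin n)) (h : Fin n → Fin (6 * m)), IsMPire m h ∧
      (∀ a b, a ≠ b → (M.empireGraph h).Adj a b) ∧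
      (M.empireGraph h).chromaticNumber = ((6 * m : ℕ) : ℕ∞)) := by
  refine ⟨fun ι A _ M h hM => M.empireGraph_colorable h (by omega) hM, ?_⟩
  have hc : m = 2 ∨ m = 3 ∨ 4 ≤ m := by omega
  rcases hc with rfl | rfl | h4
  · exact Bars.exists_empireMap_two
  · exact Bars.exists_empireMap_three
  · obtain ⟨n, rfl⟩ : ∃ n, m = n + 1 := ⟨m - 1, by omega⟩
    exact Bar.exists_empireMap (by omega)
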